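/- Let $p\ge 5$, $2\le r\le p-3$, $k\ge 0$ be integers and $0<\tau_1<\dots<\tau_k<1$; put $\tau_{k+1}=1$. For integers $P,R$ with $P > R\ge 0$, let $\mathcal T_k^{P,R}$ be the open knot vector in which $0$ and $1$ occur $P+1$ times and each $\tau_i$ occurs $P-R$ times, let $N_i^{P,R}$, $0\le i\le P+k(P-R)$, be its B-splines of degree $P$ on $[0,1]$, and let $\mathcal S(\mathcal T_k^{P,R})$ be their linear span. Put $N_i=N_i^{p,r}$, $n=p+k(p-r)$. Let $F^{(L)},F^{(R)}:[0,1]^2\to\mathbb R^2$ be injective maps whose components are tensor-product splines (linear combinations of $N_i(u)N_j(v)$), with nonvanishing Jacobian determinant on $[0,1]^2$, such that $F^{(L)}(0,v)=F^{(R)}(0,v)$ for $v\in[0,1]$ and such that the patches $\Omega^{(S)}=F^{(S)}([0,1]^2)$, $S\in\{L,R\}$, intersect exactly in the edge $\{F^{(L)}(0,v): v\in[0,1]\}$. Let $\Omega=\Omega^{(L)}\cup\Omega^{(R)}$. Assume that the two-patch parameterization is bilinear-like $G^2$ with functions $\alpha^{(S)},\beta^{(S)}$, that is, $\alpha^{(L)},\alpha^{(R)},\beta^{(L)},\beta^{(R)}$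 are real polynomials of degree at most $1$ with $\alpha^{(L)}(v)\alpha^{(R)}(v)<0$ on $[0,1]$ and, with $\beta=\alpha^{(L)}\beta^{(R)}-\alpha^{(R)}\beta^{(L)}$, for all $v\in[0,1]$ (all derivatives of $F^{(S)}$ being taken at $(0,v)$) $$\alpha^{(R)}D_uF^{(L)}-\alpha^{(L)}D_uF^{(R)}+\beta D_vF^{(L)}=0,$$ $$\alpha^{(L)}Z+2(\alpha^{(L)})'\alpha^{(R)}\beta\,D_uF^{(L)}+2\bigl(\alpha^{(L)}(\beta^{(L)})'-(\alpha^{(L)})'\beta^{(L)}\bigr)\alpha^{(R)}\beta\,D_vF^{(L)}=0,$$ where $$Z=(\alpha^{(L)})^2D_{uu}F^{(R)}-\bigl((\alpha^{(R)})^2D_{uu}F^{(L)}+2\alpha^{(R)}\beta D_{uv}F^{(L)}+\beta^2D_{vv}F^{(L)}\bigr).$$ Let $d_\alpha=\max(\deg\alpha^{(L)},\deg\alpha^{(R)})$. Let $\mathcal V^2$ be the space of all $\phi\in C^2(\Omega)$ such that, for both $S$, $g^{(S)}=\phi\circ F^{(S)}$ is a tensor-product spline $\sum_{i,j=0}^{n}d^{(S)}_{i,j}N_i(u)N_j(v)$.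 Let $\mathcal V_1^2$ (respectively $\mathcal V_2^2$) be the subspace of those $\phi\in\mathcal V^2$ with $d^{(S)}_{i,j}=0$ for all $S$, all $j$ and all $i\le 2$ (respectively all $i\ge 3$). Put $M_0=N_0+N_1+N_2$, $M_1=\frac{\tau_1}{p}(N_1+2N_2)$, $M_2=\frac{\tau_1^2}{p(p-1)}N_2$. Let $\mathcal W_2^2$ be the space of those $\phi\in\mathcal V_2^2$ for which there is a triplet $$(g_0,g_1,g_2)\in\mathcal S(\mathcal T_k^{p,r+2})\times\mathcal S(\mathcal T_k^{p-d_\alpha,r+1})\times\mathcal S(\mathcal T_k^{p-2d_\alpha,r})$$ with, for both $S\in\{L,R\}$ and all $(u,v)\in[0,1]^2$, $$g^{(S)}(u,v)=g_0(v)M_0(u)+\bigl(\alpha^{(S)}g_1+\beta^{(S)}g_0'\bigr)(v)M_1(u)+\bigl((\beta^{(S)})^2g_0''+2\alpha^{(S)}\beta^{(S)}g_1'+(\alpha^{(S)})^2g_2\bigr)(v)M_2(u).$$ Then the sum $\mathcal W^2=\mathcal V_1^2+\mathcal W_2^2$ is direct and finite-dimensional, and $$\dim\mathcal W_2^2=(k+1)(3p-3d_\alpha)+3(1-k-kr),\qquad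 \dim\mathcal V_1^2=2(p-2+k(p-r))(p+1+k(p-r)),$$ $$\dim\mathcal W^2=\dim\mathcal V_1^2+\dim\mathcal W_2^2=2(p-2+k(p-r))(p+1+k(p-r))+(k+1)(3p-3d_\alpha)+3(1-k-kr).$$ -/

import Mathlib

open Set Polynomial

noncomputable section

namespace TwoPatch

/-- The B-spline with index `i` and degree `q` (second argument) on the knot sequence `t`, given by
the Cox-de Boor recursion with the convention `x / 0 = 0`. The last nonempty knot interval, the one
that ends at the right end `1` of `[0,1]`, is closed; the other ones are half-open. -/
def bspline (t : ℕ → ℝ) : ℕ → ℕ → ℝ → ℝ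
  | 0, i, x =>
      open Classical in
      if t i < t (i + 1) ∧ t i ≤ x ∧ (x < t (i + 1) ∨ (x = t (i + 1) ∧ t (i + 1) = 1))
        then 1 else 0
  | q + 1, i, x =>
      (x - t i) / (t (i + q + 1) - t i) * bspline t q i x +
        (t (i + q + 2) - x) / (t (i + q + 2) - t (i + 1)) * bspline t q (i + 1) x

lemma knot_index_lt {p m k j : ℕ} (h₁ : ¬ j ≤ p) (h₂ : j < p + 1 + k * m) :
    (j - (p + 1)) / m < k :=
  Nat.div_lt_of_lt_mul (by rw [Nat.mul_comm]; omega)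

/-- The open knot vector of degree `p` and regularity `r` with inner knots `τ`: `p + 1` times `0`,
each inner knot `p - r` times, then `1`. (Only the entries of index `≤ 2 p + 1 + k (p - r)`
are used.) -/
def knot (p r : ℕ) {k : ℕ} (τ : Fin k → ℝ) (j : ℕ) : ℝ :=
  if h₁ : j ≤ p then 0
  else if h₂ : j < p + 1 + k * (p - r) then τ ⟨(j - (p + 1)) / (p - r), knot_index_lt h₁ h₂⟩
  else 1

/-- The number of B-splines of degree `p` on the open knot vector. -/
abbrev numB (p r k : ℕ) : ℕ := p + 1 + k * (p - r)

/-- The B-spline `N_i` of degree `p` on the open knot vector. -/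
def N (p r : ℕ) {k : ℕ} (τ : Fin k → ℝ) (i : ℕ) (x : ℝ) : ℝ :=
  bspline (knot p r τ) p i x

/-- On `[0,1]`, the function `g` belongs to the univariate spline space of degree `p`, regularity
`r` and inner knots `τ`, that is, to the span of the B-splines. -/
def IsSpline (p r : ℕ) {k : ℕ} (τ : Fin k → ℝ) (g : ℝ → ℝ) : Prop :=
  ∃ c : Fin (numB p r k) → ℝ, ∀ x ∈ Icc (0 : ℝ) 1, g x = ∑ i : Fin (numB p r k), c i * N p r τ i x

/-- The parameter domain `[0,1]²`. -/
def unitSquare : Set (ℝ × ℝ) := Icc (0 : ℝ) 1 ×ˢ Icc (0 : ℝ) 1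

/-- The tensor-product spline with (scalar or vector valued) coefficients `c`. -/
def tensorSpline (p r : ℕ) {k : ℕ} (τ : Fin k → ℝ) {E : Type*} [AddCommGroup E] [Module ℝ E]
    (c : Fin (numB p r k) → Fin (numB p r k) → E) (x : ℝ × ℝ) : E :=
  ∑ i : Fin (numB p r k), ∑ j : Fin (numB p r k), (N p r τ i x.1 * N p r τ j x.2) • c i j

/-- The two sides. -/
inductive Side
  | L
  | R

/-- Partial derivative in the first variable on `[0,1]²` (one-sided at the ends). -/
def Du {E : Type*} [NormedAddCommGroup E] [NormedSpace ℝ E] (g : ℝ × ℝ → E) (x : ℝ × ℝ) : E :=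
  derivWithin (fun s => g (s, x.2)) (Icc 0 1) x.1

/-- Partial derivative in the second variable on `[0,1]²` (one-sided at the ends). -/
def Dv {E : Type*} [NormedAddCommGroup E] [NormedSpace ℝ E] (g : ℝ × ℝ → E) (x : ℝ × ℝ) : E :=
  derivWithin (fun s => g (x.1, s)) (Icc 0 1) x.2

/-- The determinant of the `2 × 2` matrix with columns `a` and `b`. -/
def det₂ (a b : ℝ × ℝ) : ℝ := a.1 * b.2 - a.2 * b.1

/-- Two regular bijective spline patches that share exactly one whole edge, parameterized on both
sides by `v ↦ F S (0, v)`. -/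
structure IsTwoPatch (p r : ℕ) {k : ℕ} (τ : Fin k → ℝ) (F : Side → ℝ × ℝ → ℝ × ℝ) : Prop where
  spline : ∀ S, ∃ c : Fin (numB p r k) → Fin (numB p r k) → ℝ × ℝ,
    ∀ x ∈ unitSquare, F S x = tensorSpline p r τ c x
  regular : ∀ S, ∀ x ∈ unitSquare, det₂ (Du (F S) x) (Dv (F S) x) ≠ 0
  inj : ∀ S, InjOn (F S) unitSquare
  edge : ∀ v ∈ Icc (0 : ℝ) 1, F Side.L (0, v) = F Side.R (0, v)
  interface : F Side.L '' unitSquare ∩ F Side.R '' unitSquare =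
    (fun v : ℝ => F Side.L (0, v)) '' Icc (0 : ℝ) 1

/-- `β = α_L β_R - α_R β_L`. -/
def betaPoly (α β : Side → ℝ[X]) : ℝ[X] := α .L * β .R - α .R * β .L

/-- `η = 2 α_L' α_R β`. -/
def etaPoly (α β : Side → ℝ[X]) : ℝ[X] := 2 * derivative (α .L) * α .R * betaPoly α β

/-- `θ = 2 (α_L β_L' - α_L' β_L) α_R β`. -/
def thetaPoly (α β : Side → ℝ[X]) : ℝ[X] :=
  2 * (α .L * derivative (β .L) - derivative (α .L) * β .L) * α .R * betaPoly α β

/-- The vector field `Z` along the interface. -/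
def Z (F : Side → ℝ × ℝ → ℝ × ℝ) (α β : Side → ℝ[X]) (v : ℝ) : ℝ × ℝ :=
  ((α .L).eval v) ^ 2 • Du (Du (F .R)) (0, v) -
    (((α .R).eval v) ^ 2 • Du (Du (F .L)) (0, v) +
      (2 * (α .R).eval v * (betaPoly α β).eval v) • Dv (Du (F .L)) (0, v) +
      ((betaPoly α β).eval v) ^ 2 • Dv (Dv (F .L)) (0, v))

/-- The two-patch parameterization `F` is bilinear-like `G²` with the linear functions
`α S`, `β S`. -/
structure IsBilinearLike (F : Side → ℝ × ℝ → ℝ × ℝ) (α β : Side → ℝ[X]) : Prop where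
  degα : ∀ S, (α S).natDegree ≤ 1
  degβ : ∀ S, (β S).natDegree ≤ 1
  sign : ∀ v ∈ Icc (0 : ℝ) 1, (α .L).eval v * (α .R).eval v < 0
  g0 : ∀ v ∈ Icc (0 : ℝ) 1, F .L (0, v) = F .R (0, v)
  g1 : ∀ v ∈ Icc (0 : ℝ) 1,
    (α .R).eval v • Du (F .L) (0, v) - (α .L).eval v • Du (F .R) (0, v) +
      (betaPoly α β).eval v • Dv (F .L) (0, v) = 0
  g2 : ∀ v ∈ Icc (0 : ℝ) 1,
    (α .L).eval v • Z F α β v + (etaPoly α β).eval v • Du (F .L) (0, v) +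
      (thetaPoly α β).eval v • Dv (F .L) (0, v) = 0

/-- `d_α`, the maximum of the degrees of `α_L` and `α_R`. -/
def degAlpha (α : Side → ℝ[X]) : ℕ := max (α .L).natDegree (α .R).natDegree

/-- The two-patch domain. -/
def Ω (F : Side → ℝ × ℝ → ℝ × ℝ) : Set (ℝ × ℝ) := ⋃ S, F S '' unitSquare

/-- The pullback `φ ∘ F S`, as a function on `[0,1]²`. -/
def pull (F : Side → ℝ × ℝ → ℝ × ℝ) (S : Side) (φ : Ω F → ℝ) (x : unitSquare) : ℝ :=
  φ ⟨F S x, mem_iUnion.2 ⟨S, mem_image_of_mem _ x.2⟩⟩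

/-- The functions on the domain whose pullbacks are tensor-product splines with all coefficients
`d i j`, `i ∉ J`, equal to zero. -/
def columnSpace (p r : ℕ) {k : ℕ} (τ : Fin k → ℝ) (F : Side → ℝ × ℝ → ℝ × ℝ) (J : Set ℕ) :
    Submodule ℝ (Ω F → ℝ) where
  carrier := {φ | ∀ S, ∃ d : Fin (numB p r k) → Fin (numB p r k) → ℝ,
    (∀ i j : Fin (numB p r k), (i : ℕ) ∉ J → d i j = 0) ∧
      ∀ x : unitSquare, pull F S φ x = tensorSpline p r τ d x}
  zero_mem' := fun _ => ⟨0, by simp, by simp [pull, tensorSpline]⟩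
  add_mem' := by
    intro φ ψ hφ hψ S
    obtain ⟨d, hd, hd'⟩ := hφ S
    obtain ⟨e, he, he'⟩ := hψ S
    refine ⟨d + e, fun i j h => by simp [hd i j h, he i j h], fun x => ?_⟩
    have h1 := hd' x
    have h2 := he' x
    simp only [pull, tensorSpline] at h1 h2 ⊢
    simp only [Pi.add_apply, h1, h2, smul_add, Finset.sum_add_distrib]
  smul_mem' := by
    intro a φ hφ S
    obtain ⟨d, hd, hd'⟩ := hφ S
    refine ⟨a • d, fun i j h => by simp [hd i j h], fun x => ?_⟩
    have h1 := hd' x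
    simp only [pull, tensorSpline] at h1 ⊢
    simp only [Pi.smul_apply, h1, Finset.smul_sum, smul_comm a]

/-- The space of isogeometric functions. -/
def isoSpace (p r : ℕ) {k : ℕ} (τ : Fin k → ℝ) (F : Side → ℝ × ℝ → ℝ × ℝ) :
    Submodule ℝ (Ω F → ℝ) := columnSpace p r τ F univ

/-- The functions of class `C²` on the closed domain (derivatives taken within the domain). -/
def smoothSpace (F : Side → ℝ × ℝ → ℝ × ℝ) : Submodule ℝ (Ω F → ℝ) where
  carrier := {φ | ∃ f : ℝ × ℝ → ℝ, ContDiffOn ℝ 2 f (Ω F) ∧ ∀ x : Ω F, f x = φ x}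
  zero_mem' := ⟨0, contDiffOn_const, fun _ => rfl⟩
  add_mem' := by
    rintro φ ψ ⟨f, hf, hf'⟩ ⟨g, hg, hg'⟩
    exact ⟨fun x => f x + g x, hf.add hg, fun x => by simp [hf' x, hg' x]⟩
  smul_mem' := by
    rintro a φ ⟨f, hf, hf'⟩
    exact ⟨fun x => a * f x, contDiffOn_const.mul hf, fun x => by simp [hf' x]⟩

/-- `V²`: the `C²`-smooth isogeometric functions. -/
def V2 (p r : ℕ) {k : ℕ} (τ : Fin k → ℝ) (F : Side → ℝ × ℝ → ℝ × ℝ) :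
    Submodule ℝ (Ω F → ℝ) := isoSpace p r τ F ⊓ smoothSpace F

/-- `V²₁`: the functions in `V²` with `d i j = 0` for `i = 0, 1, 2`. -/
def V21 (p r : ℕ) {k : ℕ} (τ : Fin k → ℝ) (F : Side → ℝ × ℝ → ℝ × ℝ) :
    Submodule ℝ (Ω F → ℝ) := V2 p r τ F ⊓ columnSpace p r τ F {i | 3 ≤ i}

/-- `V²₂`: the functions in `V²` with `d i j = 0` for `i ≥ 3`. -/
def V22 (p r : ℕ) {k : ℕ} (τ : Fin k → ℝ) (F : Side → ℝ × ℝ → ℝ × ℝ) :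
    Submodule ℝ (Ω F → ℝ) := V2 p r τ F ⊓ columnSpace p r τ F {i | i ≤ 2}

/-- The first positive knot: `τ 0` if there is an inner knot, and `1` otherwise. -/
def tau₁ {k : ℕ} (τ : Fin k → ℝ) : ℝ := if h : 0 < k then τ ⟨0, h⟩ else 1

def M₀ (p r : ℕ) {k : ℕ} (τ : Fin k → ℝ) (u : ℝ) : ℝ :=
  N p r τ 0 u + N p r τ 1 u + N p r τ 2 u

def M₁ (p r : ℕ) {k : ℕ} (τ : Fin k → ℝ) (u : ℝ) : ℝ :=
  tau₁ τ / p * (N p r τ 1 u + 2 * N p r τ 2 u)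

def M₂ (p r : ℕ) {k : ℕ} (τ : Fin k → ℝ) (u : ℝ) : ℝ :=
  tau₁ τ ^ 2 / (p * (p - 1)) * N p r τ 2 u

/-- `g'` is the derivative of `g` on `[0,1]` (one-sided at the ends). -/
def IsDerivOnI (g g' : ℝ → ℝ) : Prop :=
  ∀ v ∈ Icc (0 : ℝ) 1, HasDerivWithinAt g (g' v) (Icc 0 1) v

/-- Both pullbacks of `φ` have the representation by the triplet `(g₀, g₁, g₂)`; here `g₀'`, `g₀''`
and `g₁'` stand for the derivatives of `g₀` and `g₁`. -/
def HasRepr (p r : ℕ) {k : ℕ} (τ : Fin k → ℝ) (F : Side → ℝ × ℝ → ℝ × ℝ) (α β : Side → ℝ[X])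
    (φ : Ω F → ℝ) (g₀ g₀' g₀'' g₁ g₁' g₂ : ℝ → ℝ) : Prop :=
  ∀ S, ∀ x : unitSquare, pull F S φ x =
    g₀ x.1.2 * M₀ p r τ x.1.1 +
      ((α S).eval x.1.2 * g₁ x.1.2 + (β S).eval x.1.2 * g₀' x.1.2) * M₁ p r τ x.1.1 +
      (((β S).eval x.1.2) ^ 2 * g₀'' x.1.2 +
        2 * (α S).eval x.1.2 * (β S).eval x.1.2 * g₁' x.1.2 +
        ((α S).eval x.1.2) ^ 2 * g₂ x.1.2) * M₂ p r τ x.1.1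

lemma IsSpline.add {p r k : ℕ} {τ : Fin k → ℝ} {g h : ℝ → ℝ} (hg : IsSpline p r τ g)
    (hh : IsSpline p r τ h) : IsSpline p r τ (g + h) := by
  obtain ⟨c, hc⟩ := hg
  obtain ⟨d, hd⟩ := hh
  exact ⟨c + d, fun x hx => by
    simp only [Pi.add_apply, hc x hx, hd x hx, add_mul, Finset.sum_add_distrib]⟩

lemma IsSpline.smul {p r k : ℕ} {τ : Fin k → ℝ} {g : ℝ → ℝ} (a : ℝ) (hg : IsSpline p r τ g) :
    IsSpline p r τ (a • g) := by
  obtain ⟨c, hc⟩ := hg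
  exact ⟨a • c, fun x hx => by
    simp only [Pi.smul_apply, hc x hx, smul_eq_mul, Finset.mul_sum, mul_assoc]⟩

/-- `W²₂`: the functions in `V²₂` that are represented by a triplet of splines
`g₀` (degree `p`, regularity `r + 2`), `g₁` (degree `p - d_α`, regularity `r + 1`) and
`g₂` (degree `p - 2 d_α`, regularity `r`). -/
def W22 (p r : ℕ) {k : ℕ} (τ : Fin k → ℝ) (F : Side → ℝ × ℝ → ℝ × ℝ) (α β : Side → ℝ[X]) :
    Submodule ℝ (Ω F → ℝ) where
  carrier := {φ | φ ∈ V22 p r τ F ∧ ∃ g₀ g₀' g₀'' g₁ g₁' g₂ : ℝ → ℝ,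
    IsSpline p (r + 2) τ g₀ ∧
    IsSpline (p - degAlpha α) (r + 1) τ g₁ ∧
    IsSpline (p - 2 * degAlpha α) r τ g₂ ∧
    IsDerivOnI g₀ g₀' ∧ IsDerivOnI g₀' g₀'' ∧ IsDerivOnI g₁ g₁' ∧
    HasRepr p r τ F α β φ g₀ g₀' g₀'' g₁ g₁' g₂}
  zero_mem' := by
    have hs : ∀ a b, IsSpline a b τ 0 := fun a b => ⟨0, by simp⟩
    have hd : IsDerivOnI 0 0 := fun v _ => hasDerivWithinAt_const v _ (0 : ℝ)
    exact ⟨Submodule.zero_mem _, 0, 0, 0, 0, 0, 0, hs _ _, hs _ _, hs _ _, hd, hd, hd,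
      fun S x => by simp [pull]⟩
  add_mem' := by
    rintro φ ψ ⟨hφ, a, b, c, d, e, f, h1, h2, h3, h4, h5, h6, h7⟩
      ⟨hψ, a', b', c', d', e', f', k1, k2, k3, k4, k5, k6, k7⟩
    refine ⟨Submodule.add_mem _ hφ hψ, a + a', b + b', c + c', d + d', e + e', f + f',
      h1.add k1, h2.add k2, h3.add k3, fun v hv => (h4 v hv).add (k4 v hv),
      fun v hv => (h5 v hv).add (k5 v hv), fun v hv => (h6 v hv).add (k6 v hv), fun S x => ?_⟩
    have e1 := h7 S x
    have e2 := k7 S x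
    simp only [pull] at e1 e2 ⊢
    simp only [Pi.add_apply, e1, e2]
    ring
  smul_mem' := by
    rintro m φ ⟨hφ, a, b, c, d, e, f, h1, h2, h3, h4, h5, h6, h7⟩
    refine ⟨Submodule.smul_mem _ m hφ, m • a, m • b, m • c, m • d, m • e, m • f,
      h1.smul m, h2.smul m, h3.smul m, fun v hv => (h4 v hv).const_smul m,
      fun v hv => (h5 v hv).const_smul m, fun v hv => (h6 v hv).const_smul m, fun S x => ?_⟩
    have e1 := h7 S x
    simp only [pull] at e1 ⊢
    simp only [Pi.smul_apply, smul_eq_mul, e1]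
    ring

/-- `W²`: the sum of `V²₁` and `W²₂`. -/
def W2 (p r : ℕ) {k : ℕ} (τ : Fin k → ℝ) (F : Side → ℝ × ℝ → ℝ × ℝ) (α β : Side → ℝ[X]) :
    Submodule ℝ (Ω F → ℝ) := V21 p r τ F ⊔ W22 p r τ F α β

end TwoPatch

end

namespace TwoPatch

/-! ### B-splines on a general knot sequence -/

section Bspline

variable {t : ℕ → ℝ}

/-! Both spaces are linear images of free coefficient spaces, so each dimension is a count of
B-splines.

Columns `i ≥ 3`: such B-splines vanish to third order at `u = 0`. A pullback built from them has
zero 2-jet along the interface, hence always glues to a `C²` function, and the coefficients on the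
two sides are independent (`V21_eq_columnSpace`, `finrank_V21`).

Columns `i ≤ 2`: modulo `u³`, the functions `M₀`, `M₁`, `M₂` are `1`, `u`, `u²/2` at the left end,
so a triplet prescribes the 2-jet of each pullback along the interface. Every triplet of splines is
admissible: degrees and regularities are chosen so that the three factors in `v` lie in the spline
space of degree `p` and regularity `r`, and the `G²` relations force the jets to fit
(`mem_V22_of_repr`). The triplet is determined by the function because `α` has no zero on `[0,1]`.
The dimension is therefore the sum of those of three spline spaces (`finrank_W22`). Directness holds
because tensor-product coefficients are unique and the two column sets are disjoint.

Two tools carry this. For splines, Marsden's identity puts the monomials and truncated powers in the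
span of the B-splines. They are independent and equally many, so both families are bases of one
space (`combI_bspline`), on which regularity, derivatives and products with polynomials are easy to
follow. For smoothness, each closed patch carries a `C²` function by local inversion of its
parameterization, and it remains to match the first and second derivatives on the common edge
(`mem_smoothSpace_of_jets`). The derivatives match in the tangential direction and, by the `G¹`
relation, transversally; differentiating along the edge matches the Hessians on pairs with a
tangential entry, and the `G²` relation supplies the last entry (`bilin_eq_of_interface`). -/

lemma bspline_eq_zero_of_lt (ht : Monotone t) {x : ℝ} :
    ∀ (q i : ℕ), x < t i → bspline t q i x = 0
  | 0, i, h => by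
      rw [bspline, if_neg]
      rintro ⟨-, h', -⟩
      exact absurd h (not_lt.2 h')
  | q + 1, i, h => by
      rw [bspline, bspline_eq_zero_of_lt ht q i h,
        bspline_eq_zero_of_lt ht q (i + 1) (h.trans_le (ht (Nat.le_succ i)))]
      simp

/-- The bound `t (i + q + 1) < 1` excludes the closed last knot interval, where the value at the
right end may be nonzero. -/
lemma bspline_eq_zero_of_le (ht : Monotone t) {x : ℝ} :
    ∀ (q i : ℕ), t (i + q + 1) ≤ x → t (i + q + 1) < 1 → bspline t q i x = 0
  | 0, i, h, h1 => by
      rw [bspline, if_neg]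
      rintro ⟨-, -, h' | ⟨-, h'⟩⟩
      · exact absurd h (not_le.2 h')
      · exact h1.ne h'
  | q + 1, i, h, h1 => by
      have hle : t (i + q + 1) ≤ t (i + (q + 1) + 1) := ht (by omega)
      have e : i + (q + 1) + 1 = i + 1 + q + 1 := by omega
      rw [bspline, bspline_eq_zero_of_le ht q i (hle.trans h) (hle.trans_lt h1),
        bspline_eq_zero_of_le ht q (i + 1) (e ▸ h) (e ▸ h1)]
      simp

lemma bspline_eq_zero_of_eq (ht : Monotone t) {x : ℝ} :
    ∀ (q i : ℕ), t i = t (i + q + 1) → bspline t q i x = 0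
  | 0, i, h => by
      rw [bspline, if_neg]
      rintro ⟨h', -, -⟩
      exact h'.ne h
  | q + 1, i, h => by
      have h1 : t i ≤ t (i + 1) := ht (by omega)
      have h2 : t (i + 1) ≤ t (i + q + 1) := ht (by omega)
      have h3 : t (i + q + 1) ≤ t (i + (q + 1) + 1) := ht (by omega)
      have e : i + (q + 1) + 1 = i + 1 + q + 1 := by omega
      rw [bspline, bspline_eq_zero_of_eq ht q i (by linarith),
        bspline_eq_zero_of_eq ht q (i + 1) (by rw [← e]; linarith)]
      simp

lemma sum_bspline_zero (ht : Monotone t) {M : ℕ} (h0 : t 0 = 0) (h1 : t M = 1) {x : ℝ}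
    (hx : x ∈ Icc (0 : ℝ) 1) : ∑ i ∈ Finset.range M, bspline t 0 i x = 1 := by
  classical
  -- Telescoping: the conjunct `t i < 1` makes the difference equal to `1` at `x = 1` on the last
  -- nonempty interval, in accordance with its being closed.
  have key : ∀ i ∈ Finset.range M, bspline t 0 i x =
      (if t i ≤ x ∧ t i < 1 then (1 : ℝ) else 0) -
        (if t (i + 1) ≤ x ∧ t (i + 1) < 1 then (1 : ℝ) else 0) := by
    intro i hi
    have hle : t i ≤ t (i + 1) := ht (Nat.le_succ i)
    have hM : t (i + 1) ≤ 1 := h1 ▸ ht (Finset.mem_range.1 hi)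
    have hx1 := hx.2
    rw [bspline]
    split_ifs <;> grind
  rw [Finset.sum_congr rfl key, Finset.sum_range_sub', h0, h1]
  simp [hx.1]

/-- **Marsden's identity**, with the dual variable in the polynomial ring. -/
theorem marsden (ht : Monotone t) {P M : ℕ} (h0 : ∀ j ≤ P, t j = 0) (h1 : ∀ j, M ≤ j → t j = 1)
    {x : ℝ} (hx : x ∈ Icc (0 : ℝ) 1) (y : ℝ[X]) : ∀ q ≤ P,
    ∑ i ∈ Finset.range M, C (bspline t q i x) * ∏ l ∈ Finset.range q, (y - C (t (i + 1 + l))) =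
      (y - C x) ^ q
  | 0, _ => by
      simp only [Finset.range_zero, Finset.prod_empty, mul_one, pow_zero]
      rw [← map_sum, sum_bspline_zero ht (h0 0 (Nat.zero_le _)) (h1 M le_rfl) hx, C_1]
  | q + 1, hq => by
      have ih := marsden ht h0 h1 hx y q (by omega)
      -- `f (i + 1)` is the second term of the recursion at index `i`. Since `f` vanishes at `0` and
      -- at `M`, where all knots involved coincide, the sum can be shifted so that both terms carry
      -- the same B-spline of degree `q`.
      set f : ℕ → ℝ[X] := fun i => C ((t (i + q + 1) - x) / (t (i + q + 1) - t i) *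
        bspline t q i x) * ∏ l ∈ Finset.range (q + 1), (y - C (t (i + l))) with hf
      have hf0 : f 0 = 0 := by
        have : bspline t q 0 x = 0 := bspline_eq_zero_of_eq ht q 0 (by
          rw [h0 0 (Nat.zero_le _), h0 _ (by omega)])
        simp [hf, this]
      have hfM : f M = 0 := by
        have : bspline t q M x = 0 := bspline_eq_zero_of_eq ht q M (by
          rw [h1 M le_rfl, h1 _ (by omega)])
        simp [hf, this]
      have shift : ∑ i ∈ Finset.range M, f (i + 1) = ∑ i ∈ Finset.range M, f i := by
        have := Finset.sum_range_succ f M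
        rw [Finset.sum_range_succ', hf0, hfM] at this
        simpa using this
      have split : ∀ i, C (bspline t (q + 1) i x) *
          ∏ l ∈ Finset.range (q + 1), (y - C (t (i + 1 + l))) =
          C ((x - t i) / (t (i + q + 1) - t i) * bspline t q i x) *
            ∏ l ∈ Finset.range (q + 1), (y - C (t (i + 1 + l))) + f (i + 1) := by
        intro i
        have e : i + 1 + q + 1 = i + q + 2 := by omega
        simp only [hf, e]
        rw [bspline, C_add, add_mul]
      rw [Finset.sum_congr rfl fun i _ => split i, Finset.sum_add_distrib, shift,
        ← Finset.sum_add_distrib, pow_succ, ← ih, Finset.sum_mul]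
      refine Finset.sum_congr rfl fun i _ => ?_
      rcases eq_or_ne (t i) (t (i + q + 1)) with h | h
      · simp [hf, bspline_eq_zero_of_eq ht q i h]
      · have hD : t (i + q + 1) - t i ≠ 0 := sub_ne_zero.2 h.symm
        -- The two weights add up to `1` and average the knots `t (i + q + 1)` and `t i` to `x`, so
        -- they combine the two extra linear factors into `y - C x`.
        have e1 : C ((x - t i) / (t (i + q + 1) - t i)) +
            C ((t (i + q + 1) - x) / (t (i + q + 1) - t i)) = 1 := by
          rw [← C_add, ← C_1]; congr 1; field_simp; ring
        have e2 : C ((x - t i) / (t (i + q + 1) - t i)) * C (t (i + q + 1)) +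
            C ((t (i + q + 1) - x) / (t (i + q + 1) - t i)) * C (t i) = C x := by
          rw [← C_mul, ← C_mul, ← C_add]; congr 1; field_simp; ring
        have a1 : ∏ l ∈ Finset.range (q + 1), (y - C (t (i + 1 + l))) =
            (∏ l ∈ Finset.range q, (y - C (t (i + 1 + l)))) * (y - C (t (i + q + 1))) := by
          rw [Finset.prod_range_succ, show i + 1 + q = i + q + 1 by omega]
        have a2 : ∏ l ∈ Finset.range (q + 1), (y - C (t (i + l))) =
            (∏ l ∈ Finset.range q, (y - C (t (i + 1 + l)))) * (y - C (t i)) := by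
          rw [Finset.prod_range_succ']
          simp only [Nat.add_zero]
          congr 1
          refine Finset.prod_congr rfl fun l _ => ?_
          rw [show i + (l + 1) = i + 1 + l by omega]
        simp only [hf, C_mul]
        rw [a1, a2]
        linear_combination (C (bspline t q i x) * ∏ l ∈ Finset.range q, (y - C (t (i + 1 + l)))) *
          (y * e1 - e2)

/-- Close to the left end of the domain, a B-spline that starts with the last `m + 1 - i` of the
zero knots vanishes to the order of its missing zero knots. -/
lemma bspline_eq_pow_mul (ht : Monotone t) {m : ℕ} (h0 : ∀ j ≤ m, t j = 0) (hm : 0 < t (m + 1)) :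
    ∀ (q i j : ℕ), i + q = m + j →
      ∃ w : ℝ[X], ∀ x, 0 ≤ x → x < t (m + 1) → bspline t q i x = x ^ j * w.eval x
  | 0, i, j, h => by
      rcases Nat.eq_zero_or_pos j with rfl | hj
      · refine ⟨1, fun x hx hx' => ?_⟩
        obtain rfl : i = m := by omega
        rw [bspline, if_pos ⟨by rwa [h0 i le_rfl], by rwa [h0 i le_rfl], Or.inl hx'⟩]
        simp
      · refine ⟨0, fun x hx hx' => ?_⟩
        rw [bspline_eq_zero_of_lt ht 0 i (hx'.trans_le (ht (by omega)))]
        simp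
  | q + 1, i, j, h => by
      obtain ⟨w₂, hw₂⟩ := bspline_eq_pow_mul ht h0 hm q (i + 1) j (by omega)
      -- The second recursion term already has order `j`. In the first one the B-spline has order `j
      -- - 1` only, and `x - t i = x` supplies the missing power. The B-spline is zero if `j = 0`
      -- (all its knots vanish) or `i > m` (its support starts later).
      have first : ∃ w : ℝ[X], ∀ x, 0 ≤ x → x < t (m + 1) →
          (x - t i) * bspline t q i x = x ^ j * w.eval x := by
        rcases le_or_gt i m with hi | hi
        · rcases Nat.eq_zero_or_pos j with rfl | hj
          · refine ⟨0, fun x hx hx' => ?_⟩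
            have : bspline t q i x = 0 := bspline_eq_zero_of_eq ht q i (by
              rw [h0 i hi, h0 _ (by omega)])
            simp [this]
          · obtain ⟨w₁, hw₁⟩ := bspline_eq_pow_mul ht h0 hm q i (j - 1) (by omega)
            refine ⟨w₁, fun x hx hx' => ?_⟩
            obtain ⟨j, rfl⟩ : ∃ j', j = j' + 1 := ⟨j - 1, by omega⟩
            rw [hw₁ x hx hx', h0 i hi, Nat.add_sub_cancel]
            ring
        · refine ⟨0, fun x hx hx' => ?_⟩
          rw [bspline_eq_zero_of_lt ht q i (hx'.trans_le (ht (by omega)))]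
          simp
      obtain ⟨w₁, hw₁⟩ := first
      refine ⟨C (t (i + q + 1) - t i)⁻¹ * w₁ +
        C (t (i + q + 2) - t (i + 1))⁻¹ * (C (t (i + q + 2)) - X) * w₂, fun x hx hx' => ?_⟩
      rw [bspline, hw₂ x hx hx']
      have := hw₁ x hx hx'
      simp only [eval_add, eval_mul, eval_C, eval_sub, eval_X, div_eq_mul_inv]
      linear_combination (t (i + q + 1) - t i)⁻¹ * this

end Bspline

/-! ### The open knot vector -/

section Knot

variable {P R k : ℕ} {τ : Fin k → ℝ}

lemma knot_of_le {j : ℕ} (h : j ≤ P) : knot P R τ j = 0 := by simp [knot, h]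

lemma knot_of_ge {j : ℕ} (h : numB P R k ≤ j) : knot P R τ j = 1 := by
  have h' : P + 1 + k * (P - R) ≤ j := h
  rw [knot, dif_neg (by omega), dif_neg (by omega)]

lemma knot_inner (l : Fin k) {s : ℕ} (hs : s < P - R) :
    knot P R τ (P + 1 + l * (P - R) + s) = τ l := by
  have hlt : P + 1 + l * (P - R) + s < P + 1 + k * (P - R) := by
    have : (l + 1 : ℕ) * (P - R) ≤ k * (P - R) := Nat.mul_le_mul_right _ l.2
    rw [Nat.add_mul, Nat.one_mul] at this
    omega
  rw [knot, dif_neg (by omega), dif_pos hlt]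
  congr 1
  apply Fin.ext
  show (P + 1 + l * (P - R) + s - (P + 1)) / (P - R) = l
  rw [show P + 1 + l * (P - R) + s - (P + 1) = s + (P - R) * l by rw [Nat.mul_comm]; omega,
    Nat.add_mul_div_left _ _ (by omega), Nat.div_eq_of_lt hs, Nat.zero_add]

lemma knot_monotone (hτ : StrictMono τ) (hτ01 : ∀ i, 0 < τ i ∧ τ i < 1) :
    Monotone (knot P R τ) := by
  intro i j hij
  have h1 : ∀ j, knot P R τ j ≤ 1 := by
    intro j
    unfold knot
    split_ifs
    · exact zero_le_one
    · exact (hτ01 _).2.le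
    · exact le_rfl
  unfold knot
  split_ifs <;> first | omega | rfl | exact (hτ01 _).1.le | exact (hτ01 _).2.le |
    exact zero_le_one | skip
  exact hτ.monotone (Fin.mk_le_mk.2 (Nat.div_le_div_right (by omega)))

lemma knot_first {s : ℕ} (hs : s < P - R) : knot P R τ (P + 1 + s) = tau₁ τ := by
  unfold tau₁
  split_ifs with h
  · simpa using knot_inner (P := P) (R := R) (τ := τ) ⟨0, h⟩ hs
  · obtain rfl : k = 0 := by omega
    exact knot_of_ge (by simp [numB])

lemma tau₁_pos (hτ01 : ∀ i, 0 < τ i ∧ τ i < 1) : 0 < tau₁ τ := by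
  unfold tau₁
  split_ifs with h
  · exact (hτ01 _).1
  · exact one_pos

lemma tau₁_le_one (hτ01 : ∀ i, 0 < τ i ∧ τ i < 1) : tau₁ τ ≤ 1 := by
  unfold tau₁
  split_ifs with h
  · exact (hτ01 _).2.le
  · exact le_rfl

end Knot

end TwoPatch

namespace TwoPatch

/-! ### Truncated powers -/

/-- The truncated power `(x - a)₊ ^ s`. -/
def truncPow (a : ℝ) (s : ℕ) (x : ℝ) : ℝ := max (x - a) 0 ^ s

lemma truncPow_of_le {a x : ℝ} {s : ℕ} (hs : s ≠ 0) (h : x ≤ a) : truncPow a s x = 0 := by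
  rw [truncPow, max_eq_right (by linarith), zero_pow hs]

lemma truncPow_of_ge {a x : ℝ} {s : ℕ} (h : a ≤ x) : truncPow a s x = (x - a) ^ s := by
  rw [truncPow, max_eq_left (by linarith)]

lemma mul_truncPow (a : ℝ) {s : ℕ} (hs : s ≠ 0) (x : ℝ) :
    x * truncPow a s x = truncPow a (s + 1) x + a * truncPow a s x := by
  rcases le_total x a with h | h
  · simp [truncPow_of_le hs h, truncPow_of_le (Nat.succ_ne_zero s) h]
  · rw [truncPow_of_ge h, truncPow_of_ge h]; ring

lemma continuous_truncPow (a : ℝ) (s : ℕ) : Continuous (truncPow a s) := by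
  unfold truncPow; fun_prop

lemma hasDerivAt_truncPow (a : ℝ) (s : ℕ) (x : ℝ) :
    HasDerivAt (truncPow a (s + 2)) ((s + 2 : ℕ) * truncPow a (s + 1) x) x := by
  have hpow : HasDerivAt (fun y => (y - a) ^ (s + 2)) ((s + 2 : ℕ) * (x - a) ^ (s + 1)) x := by
    simpa using ((hasDerivAt_id x).sub_const a).fun_pow (s + 2)
  rcases lt_trichotomy x a with h | rfl | h
  · rw [truncPow_of_le (by omega) h.le, mul_zero]
    refine (hasDerivAt_const x (0 : ℝ)).congr_of_eventuallyEq ?_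
    filter_upwards [Iio_mem_nhds h] with y hy
    exact truncPow_of_le (by omega) (le_of_lt hy)
  · rw [truncPow_of_le (by omega) le_rfl, mul_zero]
    have h1 : HasDerivWithinAt (truncPow x (s + 2)) 0 (Iic x) x :=
      (hasDerivWithinAt_const x _ (0 : ℝ)).congr (fun y hy => truncPow_of_le (by omega) hy)
        (truncPow_of_le (by omega) le_rfl)
    have h2 : HasDerivWithinAt (truncPow x (s + 2)) 0 (Ici x) x := by
      have := hpow.hasDerivWithinAt (s := Ici x)
      rw [sub_self, zero_pow (by omega), mul_zero] at this
      exact this.congr (fun y hy => truncPow_of_ge hy) (truncPow_of_ge le_rfl)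
    have := h1.union h2
    rwa [Iic_union_Ici, hasDerivWithinAt_univ] at this
  · rw [truncPow_of_ge h.le]
    refine hpow.congr_of_eventuallyEq ?_
    filter_upwards [Ioi_mem_nhds h] with y hy
    exact truncPow_of_ge (le_of_lt hy)

lemma contDiff_truncPow (a : ℝ) : ∀ n s : ℕ, n < s → ContDiff ℝ n (truncPow a s)
  | 0, s, _ => by exact_mod_cast contDiff_zero.2 (continuous_truncPow a s)
  | n + 1, s, h => by
      obtain ⟨s, rfl⟩ : ∃ s', s = s' + 2 := ⟨s - 2, by omega⟩
      have hd : deriv (truncPow a (s + 2)) = fun x => (s + 2 : ℕ) * truncPow a (s + 1) x :=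
        funext fun x => (hasDerivAt_truncPow a s x).deriv
      have := contDiff_succ_iff_deriv (𝕜 := ℝ) (n := n) (f := truncPow a (s + 2))
      push_cast
      rw [this]
      refine ⟨fun x => (hasDerivAt_truncPow a s x).differentiableAt, by simp, ?_⟩
      rw [hd]
      exact contDiff_const.mul (contDiff_truncPow a n (s + 1) (by omega))

/-- The monomials and truncated powers that form a basis of the space of splines. -/
def truncGen (P R : ℕ) {k : ℕ} (τ : Fin k → ℝ) : Fin (P + 1) ⊕ (Fin k × Fin (P - R)) → ℝ → ℝ
  | .inl i => fun x => x ^ (i : ℕ)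
  | .inr (l, s) => truncPow (τ l) (R + 1 + s)

/-- The space of splines on the whole real line. -/
def truncSpace (P R : ℕ) {k : ℕ} (τ : Fin k → ℝ) : Submodule ℝ (ℝ → ℝ) :=
  Submodule.span ℝ (range (truncGen P R τ))

/-! ### Products, derivatives and smoothness in the span of the truncated powers -/

section truncSpace

variable {P R k : ℕ} {τ : Fin k → ℝ}

lemma pow_mem_truncSpace {i : ℕ} (hi : i ≤ P) : (fun x : ℝ => x ^ i) ∈ truncSpace P R τ :=
  Submodule.subset_span ⟨.inl ⟨i, by omega⟩, rfl⟩

lemma truncPow_mem_truncSpace (l : Fin k) {s : ℕ} (h1 : R < s) (h2 : s ≤ P) :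
    truncPow (τ l) s ∈ truncSpace P R τ :=
  Submodule.subset_span ⟨.inr (l, ⟨s - (R + 1), by omega⟩), by
    show truncPow (τ l) (R + 1 + (s - (R + 1))) = _
    rw [show R + 1 + (s - (R + 1)) = s by omega]⟩

lemma truncSpace_induction {p : (ℝ → ℝ) → Prop} (hpow : ∀ i ≤ P, p fun x => x ^ i)
    (htrunc : ∀ (l : Fin k) (s : ℕ), R < s → s ≤ P → p (truncPow (τ l) s))
    (zero : p 0) (add : ∀ f g, p f → p g → p (f + g)) (smul : ∀ (a : ℝ) f, p f → p (a • f))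
    {f : ℝ → ℝ} (hf : f ∈ truncSpace P R τ) : p f := by
  refine Submodule.span_induction (p := fun f _ => p f) ?_ zero (fun f g _ _ => add f g)
    (fun a f _ => smul a f) hf
  rintro _ ⟨i | ⟨l, s⟩, rfl⟩
  · exact hpow i (by omega)
  · exact htrunc l _ (by omega) (by omega)

lemma truncSpace_mono {P' R' : ℕ} (hP : P ≤ P') (hR : R' ≤ R) :
    truncSpace P R τ ≤ truncSpace P' R' τ := fun _ hf =>
  truncSpace_induction (fun _ hi => pow_mem_truncSpace (hi.trans hP))
    (fun l _ h1 h2 => truncPow_mem_truncSpace l (by omega) (by omega)) (Submodule.zero_mem _)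
    (fun _ _ => Submodule.add_mem _) (fun a _ => Submodule.smul_mem _ a) hf

lemma mul_mem_truncSpace {f : ℝ → ℝ} (hf : f ∈ truncSpace P R τ) :
    (fun x => x * f x) ∈ truncSpace (P + 1) R τ := by
  refine truncSpace_induction (p := fun f => (fun x => x * f x) ∈ truncSpace (P + 1) R τ)
    (fun i hi => ?_) (fun l s h1 h2 => ?_) ?_ (fun f g hf hg => ?_) (fun a f hf => ?_) hf
  · have : (fun x : ℝ => x * x ^ i) = fun x => x ^ (i + 1) := by ext x; ring
    rw [this]
    exact pow_mem_truncSpace (by omega)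
  · have : (fun x : ℝ => x * truncPow (τ l) s x) =
        truncPow (τ l) (s + 1) + τ l • truncPow (τ l) s :=
      funext fun x => mul_truncPow _ (by omega) x
    rw [this]
    exact Submodule.add_mem _ (truncPow_mem_truncSpace l (by omega) (by omega))
      (Submodule.smul_mem _ _ (truncPow_mem_truncSpace l (by omega) (by omega)))
  · convert Submodule.zero_mem _ using 1
    ext x; simp
  · convert Submodule.add_mem _ hf hg using 1
    ext x; simp [mul_add]
  · convert Submodule.smul_mem _ a hf using 1
    ext x; simp [mul_left_comm]

lemma linear_mul_mem_truncSpace {q : ℝ[X]} (hq : q.natDegree ≤ 1) {f : ℝ → ℝ}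
    (hf : f ∈ truncSpace P R τ) : (fun x => q.eval x * f x) ∈ truncSpace (P + 1) R τ := by
  have h : (fun x => q.eval x * f x) = q.coeff 1 • (fun x => x * f x) + q.coeff 0 • f := by
    ext x
    conv_lhs => rw [Polynomial.eq_X_add_C_of_natDegree_le_one hq]
    simp
    ring
  rw [h]
  exact Submodule.add_mem _ (Submodule.smul_mem _ _ (mul_mem_truncSpace hf))
    (Submodule.smul_mem _ _ (truncSpace_mono (by omega) le_rfl hf))

/-- Multiplication by a polynomial of degree at most `d ≤ 1` raises the degree by `d`. -/
lemma poly_mul_mem_truncSpace {d : ℕ} (hd : d ≤ 1) {q : ℝ[X]} (hq : q.natDegree ≤ d) {f : ℝ → ℝ}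
    (hf : f ∈ truncSpace P R τ) : (fun x => q.eval x * f x) ∈ truncSpace (P + d) R τ := by
  rcases Nat.le_one_iff_eq_zero_or_eq_one.1 hd with rfl | rfl
  · have h : (fun x => q.eval x * f x) = q.coeff 0 • f := by
      ext x
      conv_lhs => rw [Polynomial.eq_C_of_natDegree_le_zero hq]
      simp
    rw [h]
    exact Submodule.smul_mem _ _ hf
  · exact linear_mul_mem_truncSpace hq hf

lemma exists_deriv_mem_truncSpace {f : ℝ → ℝ} (hf : f ∈ truncSpace (P + 1) (R + 1) τ) :
    ∃ f' ∈ truncSpace P R τ, ∀ x, HasDerivAt f (f' x) x := by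
  refine truncSpace_induction (p := fun f => ∃ f' ∈ truncSpace P R τ, ∀ x, HasDerivAt f (f' x) x)
    (fun i hi => ?_) (fun l s h1 h2 => ?_) ?_ ?_ ?_ hf
  · refine ⟨(i : ℝ) • fun x => x ^ (i - 1),
      Submodule.smul_mem _ _ (pow_mem_truncSpace (by omega)), fun x => ?_⟩
    simpa using hasDerivAt_pow i x
  · obtain ⟨s, rfl⟩ : ∃ s', s = s' + 2 := ⟨s - 2, by omega⟩
    exact ⟨((s + 2 : ℕ) : ℝ) • truncPow (τ l) (s + 1),
      Submodule.smul_mem _ _ (truncPow_mem_truncSpace l (by omega) (by omega)),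
      fun x => hasDerivAt_truncPow _ _ x⟩
  · exact ⟨0, Submodule.zero_mem _, fun x => hasDerivAt_const x 0⟩
  · rintro f g ⟨f', hf', hf⟩ ⟨g', hg', hg⟩
    exact ⟨f' + g', Submodule.add_mem _ hf' hg', fun x => (hf x).add (hg x)⟩
  · rintro a f ⟨f', hf', hf⟩
    exact ⟨a • f', Submodule.smul_mem _ _ hf', fun x => (hf x).const_smul a⟩

lemma contDiff_of_mem_truncSpace {n : ℕ} (hn : n ≤ R) {f : ℝ → ℝ} (hf : f ∈ truncSpace P R τ) :
    ContDiff ℝ n f :=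
  truncSpace_induction (p := ContDiff ℝ n) (fun i _ => contDiff_id.pow i)
    (fun l s h1 _ => contDiff_truncPow _ n s (by omega)) contDiff_const
    (fun _ _ hf hg => hf.add hg) (fun a _ hf => contDiff_const.smul hf) hf

end truncSpace

/-! ### Linear independence of the truncated powers -/

lemma eq_zero_of_eventually_eval_eq_zero {q : ℝ[X]} {a : ℝ}
    (h : ∀ᶠ x in nhdsWithin a (Ioi a), q.eval x = 0) : q = 0 := by
  obtain ⟨b, hb, hb'⟩ := mem_nhdsGT_iff_exists_Ioo_subset.1 h
  exact Polynomial.eq_zero_of_infinite_isRoot q ((Ioo_infinite hb).mono hb')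

section

variable {P R k : ℕ} {τ : Fin k → ℝ}

/-- Sweep from left to right. Just after `0` only the monomials are alive; just after `τ l` the
truncated powers of later knots still vanish and those of earlier knots have been eliminated by
induction. -/
lemma truncGen_coeff_eq_zero (hτ : StrictMono τ) (hτ01 : ∀ i, 0 < τ i ∧ τ i < 1)
    {c : Fin (P + 1) ⊕ (Fin k × Fin (P - R)) → ℝ}
    (hc : ∀ x ∈ Icc (0 : ℝ) 1, ∑ j, c j * truncGen P R τ j x = 0) : c = 0 := by
  simp only [Fintype.sum_sum_type, Fintype.sum_prod_type, truncGen] at hc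
  have h0 : ∀ i, c (.inl i) = 0 := by
    have : (∑ i : Fin (P + 1), C (c (.inl i)) * X ^ (i : ℕ)) = 0 := by
      refine eq_zero_of_eventually_eval_eq_zero (a := 0) ?_
      have h1 : ∀ᶠ x in nhdsWithin (0 : ℝ) (Ioi 0), ∀ l, x < τ l :=
        Filter.eventually_all.2 fun l => nhdsWithin_le_nhds (Iio_mem_nhds (hτ01 l).1)
      filter_upwards [h1, nhdsWithin_le_nhds (Iio_mem_nhds one_pos), self_mem_nhdsWithin]
        with x hx hx1 hx0
      have := hc x ⟨le_of_lt hx0, le_of_lt hx1⟩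
      rw [Finset.sum_eq_zero (s := Finset.univ (α := Fin k)), add_zero] at this
      · simpa [eval_finsetSum] using this
      · intro l _
        refine Finset.sum_eq_zero fun s _ => ?_
        rw [truncPow_of_le (by omega) (hx l).le, mul_zero]
    intro i
    have h2 := congrArg (fun q => q.coeff (i : ℕ)) this
    simpa [finsetSum_coeff, coeff_X_pow, Fin.val_inj] using h2
  have h1 : ∀ (n : ℕ) (l : Fin k), (l : ℕ) = n → ∀ s, c (.inr (l, s)) = 0 := by
    intro n
    induction n using Nat.strong_induction_on with
    | _ n ih =>
      intro l hl
      have : (∑ s : Fin (P - R), C (c (.inr (l, s))) * (X - C (τ l)) ^ (R + 1 + s : ℕ)) = 0 := by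
        refine eq_zero_of_eventually_eval_eq_zero (a := τ l) ?_
        have h1 : ∀ᶠ x in nhdsWithin (τ l) (Ioi (τ l)), ∀ l', l < l' → x < τ l' :=
          Filter.eventually_all.2 fun l' => by
            by_cases h : l < l'
            · filter_upwards [nhdsWithin_le_nhds (Iio_mem_nhds (hτ h))] with x hx _ using hx
            · exact Filter.Eventually.of_forall fun _ h' => absurd h' h
        filter_upwards [h1, nhdsWithin_le_nhds (Iio_mem_nhds (hτ01 l).2), self_mem_nhdsWithin]
          with x hx hx1 hx0
        have := hc x ⟨(hτ01 l).1.le.trans (le_of_lt hx0), le_of_lt hx1⟩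
        rw [Finset.sum_eq_zero fun i _ => by rw [h0, zero_mul], zero_add,
          Finset.sum_eq_single l] at this
        · rw [← this, eval_finsetSum]
          refine Finset.sum_congr rfl fun s _ => ?_
          rw [truncPow_of_ge (le_of_lt hx0)]
          simp
        · intro l' _ hne
          refine Finset.sum_eq_zero fun s _ => ?_
          rcases lt_or_gt_of_ne hne with h | h
          · rw [ih l' (by omega) l' rfl, zero_mul]
          · rw [truncPow_of_le (by omega) (hx l' h).le, mul_zero]
        · exact fun h => absurd (Finset.mem_univ _) h
      intro s
      -- Translation by `τ l` turns the powers of `X - C (τ l)` into powers of `X`, whose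
      -- coefficients can be read off.
      have h2 := congrArg (fun q => (compRingHom (X + C (τ l)) q).coeff (R + 1 + s : ℕ)) this
      simp only [map_sum, map_mul, map_pow, map_zero] at h2
      simpa [finsetSum_coeff, coeff_X_pow, Fin.val_inj] using h2
  ext j
  rcases j with i | ⟨l, s⟩
  · exact h0 i
  · exact h1 l l rfl s

/-! ### Monomials and truncated powers are combinations of B-splines -/

/-- The coefficients of Marsden's identity. -/
lemma marsden_coeff (hτ : StrictMono τ) (hτ01 : ∀ i, 0 < τ i ∧ τ i < 1) {x : ℝ}
    (hx : x ∈ Icc (0 : ℝ) 1) (a : ℝ) (s : ℕ) :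
    ∑ i ∈ Finset.range (numB P R k), N P R τ i x *
      (∏ l ∈ Finset.range P, (X + C a - C (knot P R τ (i + 1 + l)))).coeff s =
      (a - x) ^ (P - s) * P.choose s := by
  have h := congrArg (fun q => q.coeff s) (marsden (knot_monotone hτ hτ01)
    (fun j hj => knot_of_le (P := P) (R := R) hj) (fun j hj => knot_of_ge hj) hx (X + C a) P le_rfl)
  simp only [finsetSum_coeff, coeff_C_mul] at h
  rw [show (X + C a - C x : ℝ[X]) = X + C (a - x) by rw [C_sub]; ring, coeff_X_add_C_pow] at h
  exact h

lemma pow_isSpline (hτ : StrictMono τ) (hτ01 : ∀ i, 0 < τ i ∧ τ i < 1) {j : ℕ} (hj : j ≤ P) :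
    IsSpline P R τ fun x => x ^ j := by
  set ψ : ℕ → ℝ[X] := fun i => ∏ l ∈ Finset.range P, (X + C 0 - C (knot P R τ (i + 1 + l)))
  -- Marsden's identity with dual variable `X` has `(-x) ^ j * P.choose (P - j)` as its coefficient
  -- of index `P - j`; the constants normalize this to `x ^ j`.
  refine ⟨fun i => (-1) ^ j * ((P.choose (P - j) : ℝ))⁻¹ * (ψ i).coeff (P - j), fun x hx => ?_⟩
  have h : ∑ i ∈ Finset.range (numB P R k), N P R τ i x * (ψ i).coeff (P - j) = _ :=
    marsden_coeff (P := P) (R := R) hτ hτ01 hx 0 (P - j)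
  rw [Finset.sum_range] at h
  have hne : (P.choose (P - j) : ℝ) ≠ 0 := by
    exact_mod_cast (Nat.choose_pos (Nat.sub_le P j)).ne'
  simp only [mul_assoc]
  simp only [mul_comm _ (N P R τ _ x)]
  rw [← Finset.mul_sum, ← Finset.mul_sum, h, Nat.sub_sub_self hj, zero_sub, neg_pow x]
  have : ((-1 : ℝ) ^ j) * (-1) ^ j = 1 := by rw [← mul_pow]; simp
  field_simp
  linear_combination (-x ^ j) * this

/-- Marsden's identity centred at `τ l` expands `(x - τ l) ^ j`; keeping only the indices from `a`
on, the first position of `τ l` in the knot vector, truncates it. To the left of `τ l` the kept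
B-splines vanish. To the right nothing is lost: a dropped B-spline either ends at or before `τ l`,
or has all `P - R` copies of `τ l` among its inner knots. In that case its dual polynomial is
divisible by `X ^ (P - R)`, which kills the coefficient of index `P - j < P - R`. -/
lemma truncPow_isSpline (hτ : StrictMono τ) (hτ01 : ∀ i, 0 < τ i ∧ τ i < 1) (l : Fin k) {j : ℕ}
    (h1 : R < j) (h2 : j ≤ P) : IsSpline P R τ (truncPow (τ l) j) := by
  classical
  set a : ℕ := P + 1 + l * (P - R) with ha
  have hmono := knot_monotone (P := P) (R := R) hτ hτ01
  set ψ : ℕ → ℝ[X] := fun i => ∏ n ∈ Finset.range P, (X + C (τ l) - C (knot P R τ (i + 1 + n)))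
    with hψ
  have hψ0 : ∀ i < a, a + (P - R) ≤ i + P + 1 → (ψ i).coeff (P - j) = 0 := by
    intro i hi hi'
    refine (Polynomial.X_pow_dvd_iff (n := P - R)).1 ?_ _ (by omega)
    have hsub : Finset.Ico (a - (i + 1)) (a - (i + 1) + (P - R)) ⊆ Finset.range P := by
      intro n hn
      rw [Finset.mem_Ico] at hn
      exact Finset.mem_range.2 (by omega)
    refine dvd_trans (dvd_of_eq ?_) (Finset.prod_dvd_prod_of_subset _ _ _ hsub)
    rw [Finset.prod_congr rfl (g := fun _ => X), Finset.prod_const, Nat.card_Ico,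
      Nat.add_sub_cancel_left]
    intro n hn
    rw [Finset.mem_Ico] at hn
    have := knot_inner (P := P) (R := R) (τ := τ) l (s := i + 1 + n - a) (by omega)
    rw [← ha, show a + (i + 1 + n - a) = i + 1 + n by omega] at this
    rw [this]
    ring
  have hge : ∀ i, a ≤ i → τ l ≤ knot P R τ i := by
    intro i hi
    have := knot_inner (P := P) (R := R) (τ := τ) l (s := 0) (by omega)
    rw [← this]
    exact hmono hi
  have hle : ∀ i, i + P + 1 < a + (P - R) → knot P R τ (i + P + 1) ≤ τ l := by
    intro i hi
    have := knot_inner (P := P) (R := R) (τ := τ) l (s := P - R - 1) (by omega)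
    rw [← this]
    exact hmono (by omega)
  refine ⟨fun i => if a ≤ (i : ℕ) then (-1) ^ j * ((P.choose (P - j) : ℝ))⁻¹ *
    (ψ i).coeff (P - j) else 0, fun x hx => ?_⟩
  rcases lt_or_ge x (τ l) with hxl | hxl
  · rw [truncPow_of_le (by omega) hxl.le, Finset.sum_eq_zero]
    intro i _
    dsimp only
    split_ifs with hi
    · rw [N, bspline_eq_zero_of_lt hmono _ _ (hxl.trans_le (hge i hi)), mul_zero]
    · rw [zero_mul]
  · have h : ∑ i ∈ Finset.range (numB P R k), N P R τ i x * (ψ i).coeff (P - j) = _ :=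
      marsden_coeff (P := P) (R := R) hτ hτ01 hx (τ l) (P - j)
    rw [Finset.sum_range] at h
    have hne : (P.choose (P - j) : ℝ) ≠ 0 := by
      exact_mod_cast (Nat.choose_pos (Nat.sub_le P j)).ne'
    have key : ∀ i : Fin (numB P R k), (if a ≤ (i : ℕ) then (-1) ^ j *
        ((P.choose (P - j) : ℝ))⁻¹ * (ψ i).coeff (P - j) else 0) * N P R τ i x =
        (-1) ^ j * (((P.choose (P - j) : ℝ))⁻¹ * (N P R τ i x * (ψ i).coeff (P - j))) := by
      intro i
      split_ifs with hi
      · ring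
      · rcases le_or_gt (a + (P - R)) (i + P + 1) with hi' | hi'
        · rw [hψ0 i (by omega) hi']; ring
        · have := hle i hi'
          rw [N, bspline_eq_zero_of_le hmono _ _ (this.trans hxl) (this.trans_lt (hτ01 l).2)]
          ring
    rw [truncPow_of_ge hxl, Finset.sum_congr rfl fun i _ => key i, ← Finset.mul_sum,
      ← Finset.mul_sum, h, Nat.sub_sub_self h2, ← neg_sub x, neg_pow (x - τ l)]
    have : ((-1 : ℝ) ^ j) * (-1) ^ j = 1 := by rw [← mul_pow]; simp
    field_simp
    linear_combination (-(x - τ l) ^ j) * this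

lemma truncGen_isSpline (hτ : StrictMono τ) (hτ01 : ∀ i, 0 < τ i ∧ τ i < 1)
    (j : Fin (P + 1) ⊕ (Fin k × Fin (P - R))) : IsSpline P R τ (truncGen P R τ j) := by
  rcases j with i | ⟨l, s⟩
  · exact pow_isSpline hτ hτ01 (by omega)
  · exact truncPow_isSpline hτ hτ01 l (by omega) (by omega)

/-! ### The B-splines form a basis of the space of splines -/

/-- Linear combinations of functions, restricted to `[0,1]`. -/
def combI {ι : Type*} [Fintype ι] (b : ι → ℝ → ℝ) : (ι → ℝ) →ₗ[ℝ] (Icc (0 : ℝ) 1 → ℝ) :=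
  Fintype.linearCombination ℝ fun i (x : Icc (0 : ℝ) 1) => b i x

lemma combI_apply {ι : Type*} [Fintype ι] (b : ι → ℝ → ℝ) (c : ι → ℝ) (x : Icc (0 : ℝ) 1) :
    combI b c x = ∑ i, c i * b i x := by
  simp [combI, Fintype.linearCombination_apply, Finset.sum_apply]

/-- A dimension count gives both claims at once: the range of the truncated powers lies in that of
the B-splines and already has dimension `numB P R k`, the number of B-splines. -/
lemma combI_bspline (hτ : StrictMono τ) (hτ01 : ∀ i, 0 < τ i ∧ τ i < 1) :
    LinearMap.ker (combI fun i : Fin (numB P R k) => N P R τ i) = ⊥ ∧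
      LinearMap.range (combI fun i : Fin (numB P R k) => N P R τ i) =
        LinearMap.range (combI (truncGen P R τ)) := by
  set Φ := combI fun i : Fin (numB P R k) => N P R τ i
  set Ψ := combI (truncGen P R τ)
  have hΨ : LinearMap.ker Ψ = ⊥ := by
    refine LinearMap.ker_eq_bot'.2 fun c hc => truncGen_coeff_eq_zero hτ hτ01 fun x hx => ?_
    have := congrFun hc ⟨x, hx⟩
    rwa [combI_apply] at this
  have hle : LinearMap.range Ψ ≤ LinearMap.range Φ := by
    rintro _ ⟨c, rfl⟩
    have : ∀ j, (fun x : Icc (0 : ℝ) 1 => truncGen P R τ j x) ∈ LinearMap.range Φ := by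
      intro j
      obtain ⟨d, hd⟩ := truncGen_isSpline hτ hτ01 j
      exact ⟨d, funext fun x => by rw [combI_apply, hd x x.2]⟩
    have e : Ψ c = ∑ j, c j • fun x : Icc (0 : ℝ) 1 => truncGen P R τ j x := by
      simp [Ψ, combI, Fintype.linearCombination_apply]
    rw [e]
    exact Submodule.sum_mem _ fun j _ => Submodule.smul_mem _ _ (this j)
  have hΨr : Module.finrank ℝ (LinearMap.range Ψ) = numB P R k := by
    rw [LinearMap.finrank_range_of_inj (LinearMap.ker_eq_bot.1 hΨ)]
    simp [numB]
  have hΦ := LinearMap.finrank_range_add_finrank_ker Φ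
  rw [Module.finrank_fintype_fun_eq_card, Fintype.card_fin] at hΦ
  have h1 := Submodule.finrank_mono hle
  refine ⟨Submodule.finrank_eq_zero.1 (by omega), (Submodule.eq_of_le_of_finrank_le hle ?_).symm⟩
  omega

theorem bspline_coeff_eq_zero (hτ : StrictMono τ) (hτ01 : ∀ i, 0 < τ i ∧ τ i < 1)
    {c : Fin (numB P R k) → ℝ} (hc : ∀ x ∈ Icc (0 : ℝ) 1, ∑ i, c i * N P R τ i x = 0) : c = 0 :=
  LinearMap.ker_eq_bot'.1 (combI_bspline hτ hτ01).1 c <| funext fun x => by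
    rw [combI_apply, hc x x.2]; rfl

theorem isSpline_iff (hτ : StrictMono τ) (hτ01 : ∀ i, 0 < τ i ∧ τ i < 1) {g : ℝ → ℝ} :
    IsSpline P R τ g ↔ ∃ f ∈ truncSpace P R τ, ∀ x ∈ Icc (0 : ℝ) 1, g x = f x := by
  have key := (combI_bspline (P := P) (R := R) hτ hτ01).2
  have h1 : IsSpline P R τ g ↔ (fun x : Icc (0 : ℝ) 1 => g x) ∈
      LinearMap.range (combI fun i : Fin (numB P R k) => N P R τ i) := by
    refine exists_congr fun c => ⟨fun h => funext fun x => ?_, fun h x hx => ?_⟩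
    · rw [combI_apply, h x x.2]
    · rw [← congrFun h ⟨x, hx⟩, combI_apply]
  rw [h1, key]
  constructor
  · rintro ⟨c, hc⟩
    refine ⟨∑ j, c j • truncGen P R τ j, Submodule.sum_mem _ fun j _ => Submodule.smul_mem _ _
      (Submodule.subset_span ⟨j, rfl⟩), fun x hx => ?_⟩
    rw [← congrFun hc ⟨x, hx⟩, combI_apply]
    simp
  · rintro ⟨f, hf, h⟩
    obtain ⟨c, hc⟩ := (Submodule.mem_span_range_iff_exists_fun ℝ).1 hf
    refine ⟨c, funext fun x => ?_⟩
    rw [combI_apply, h x x.2, ← hc]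
    simp

/-- Every spline is the restriction of a function from the space of splines on the line. -/
lemma exists_bspline_ext (hτ : StrictMono τ) (hτ01 : ∀ i, 0 < τ i ∧ τ i < 1) :
    ∃ b : ℕ → ℝ → ℝ, ∀ i < numB P R k,
      b i ∈ truncSpace P R τ ∧ ∀ x ∈ Icc (0 : ℝ) 1, N P R τ i x = b i x := by
  have : ∀ i, ∃ f : ℝ → ℝ, i < numB P R k →
      f ∈ truncSpace P R τ ∧ ∀ x ∈ Icc (0 : ℝ) 1, N P R τ i x = f x := by
    intro i
    by_cases h : i < numB P R k
    · have hs : IsSpline P R τ (N P R τ i) := by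
        refine ⟨Pi.single ⟨i, h⟩ 1, fun x _ => ?_⟩
        rw [Finset.sum_eq_single ⟨i, h⟩] <;> simp +contextual
      obtain ⟨f, hf, hf'⟩ := (isSpline_iff hτ hτ01).1 hs
      exact ⟨f, fun _ => ⟨hf, hf'⟩⟩
    · exact ⟨0, fun h' => absurd h' h⟩
  choose b hb using this
  exact ⟨b, hb⟩

end

end TwoPatch

namespace TwoPatch

/-! ### The behaviour of the B-splines at the left end of the domain -/

section LeftEnd

variable {P R k : ℕ} {τ : Fin k → ℝ}

lemma bspline_eq_cube_mul (hτ : StrictMono τ) (hτ01 : ∀ i, 0 < τ i ∧ τ i < 1) (hRP : R < P)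
    {i : ℕ} (hi : 3 ≤ i) :
    ∃ q : ℝ[X], ∀ u, 0 ≤ u → u < tau₁ τ → N P R τ i u = u ^ 3 * q.eval u := by
  have h1 : knot P R τ (P + 1) = tau₁ τ := knot_first (s := 0) (by omega)
  obtain ⟨w, hw⟩ := bspline_eq_pow_mul (knot_monotone (P := P) (R := R) hτ hτ01)
    (fun j hj => knot_of_le hj) (by rw [h1]; exact tau₁_pos hτ01) P i i (by omega)
  refine ⟨X ^ (i - 3) * w, fun u hu hu' => ?_⟩
  rw [N, hw u hu (by rwa [h1])]
  simp only [eval_mul, eval_pow, eval_X]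
  rw [← mul_assoc, ← pow_add, show 3 + (i - 3) = i by omega]

lemma sum_bspline_eq_cube_mul (hτ : StrictMono τ) (hτ01 : ∀ i, 0 < τ i ∧ τ i < 1) (hRP : R < P)
    {ι : Type*} (s : Finset ι) (f : ι → ℕ) (hf : ∀ i ∈ s, 3 ≤ f i) (c : ι → ℝ) :
    ∃ q : ℝ[X], ∀ u, 0 ≤ u → u < tau₁ τ →
      ∑ i ∈ s, N P R τ (f i) u * c i = u ^ 3 * q.eval u := by
  have : ∀ i, ∃ q : ℝ[X], i ∈ s → ∀ u, 0 ≤ u → u < tau₁ τ →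
      N P R τ (f i) u = u ^ 3 * q.eval u := by
    intro i
    by_cases h : i ∈ s
    · obtain ⟨q, hq⟩ := bspline_eq_cube_mul hτ hτ01 hRP (hf i h)
      exact ⟨q, fun _ => hq⟩
    · exact ⟨0, fun h' => absurd h' h⟩
  choose q hq using this
  refine ⟨∑ i ∈ s, q i * C (c i), fun u hu hu' => ?_⟩
  rw [eval_finsetSum, Finset.mul_sum]
  refine Finset.sum_congr rfl fun i hi => ?_
  rw [hq i hi u hu hu', eval_mul, eval_C, mul_assoc]

/-- The knots with indices `i + 1, …, i + P` are `P - i` zeros followed by `i` copies of the first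
positive knot, whose multiplicity is large enough as long as `i ≤ P - R`. -/
lemma knot_prod {i : ℕ} (hi : i ≤ P - R) :
    ∏ l ∈ Finset.range P, (X + C 0 - C (knot P R τ (i + 1 + l)) : ℝ[X]) =
      X ^ (P - i) * (X - C (tau₁ τ)) ^ i := by
  obtain ⟨n, rfl⟩ : ∃ n, P = n + i := ⟨P - i, by omega⟩
  rw [Finset.prod_range_add, Nat.add_sub_cancel]
  congr 1
  · rw [Finset.prod_congr rfl (g := fun _ => X), Finset.prod_const, Finset.card_range]
    intro l hl
    have := Finset.mem_range.1 hl
    rw [knot_of_le (by omega)]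
    simp
  · rw [Finset.prod_congr rfl (g := fun _ => X - C (tau₁ τ)), Finset.prod_const, Finset.card_range]
    intro l hl
    have := Finset.mem_range.1 hl
    rw [show i + 1 + (n + l) = n + i + 1 + l by omega, knot_first (by omega)]
    simp

/-- Modulo `u ^ 3` only the first three B-splines contribute to Marsden's identity. The cases `s =
P`, `P - 1`, `P - 2` yield the constants in `M₀`, `M₁`, `M₂`. The condition `R + 2 ≤ P` lets
`knot_prod` reach `i = 2`. -/
lemma marsden_coeff_left (hτ : StrictMono τ) (hτ01 : ∀ i, 0 < τ i ∧ τ i < 1) (hRP : R + 2 ≤ P)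
    (s : ℕ) : ∃ q : ℝ[X], ∀ u, 0 ≤ u → u < tau₁ τ →
      ∑ i ∈ Finset.range 3, N P R τ i u * (X ^ (P - i) * (X - C (tau₁ τ)) ^ i : ℝ[X]).coeff s =
        (-u) ^ (P - s) * P.choose s + u ^ 3 * q.eval u := by
  obtain ⟨K, hK⟩ : ∃ K, numB P R k = 3 + K := ⟨numB P R k - 3, by simp only [numB]; omega⟩
  obtain ⟨q, hq⟩ := sum_bspline_eq_cube_mul (P := P) (R := R) hτ hτ01 (by omega) (Finset.range K)
    (fun i => 3 + i) (fun _ _ => by omega)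
    (fun i => (∏ l ∈ Finset.range P, (X + C 0 - C (knot P R τ (3 + i + 1 + l)) : ℝ[X])).coeff s)
  refine ⟨-q, fun u hu hu' => ?_⟩
  have h := marsden_coeff (P := P) (R := R) hτ hτ01
    (x := u) ⟨hu, hu'.le.trans (tau₁_le_one hτ01)⟩ 0 s
  rw [hK, Finset.sum_range_add, hq u hu hu', zero_sub] at h
  rw [eval_neg, ← h, Finset.sum_congr rfl (g := fun i => N P R τ i u *
    (∏ l ∈ Finset.range P, (X + C 0 - C (knot P R τ (i + 1 + l)) : ℝ[X])).coeff s)]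
  · ring
  · intro i hi
    have := Finset.mem_range.1 hi
    rw [knot_prod (by omega)]

lemma M₀_left (hτ : StrictMono τ) (hτ01 : ∀ i, 0 < τ i ∧ τ i < 1) (hRP : R + 2 ≤ P) :
    ∃ q : ℝ[X], ∀ u, 0 ≤ u → u < tau₁ τ → M₀ P R τ u = 1 + u ^ 3 * q.eval u := by
  obtain ⟨q, hq⟩ := marsden_coeff_left hτ hτ01 hRP P
  refine ⟨q, fun u hu hu' => ?_⟩
  have := hq u hu hu'
  have e : ∀ i ≤ 2, (X ^ (P - i) * (X - C (tau₁ τ)) ^ i : ℝ[X]).coeff P = 1 := by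
    intro i hi
    rw [coeff_X_pow_mul', if_pos (by omega), show P - (P - i) = i by omega]
    simpa [natDegree_pow] using ((monic_X_sub_C (tau₁ τ)).pow i).coeff_natDegree
  rw [Finset.sum_range_succ, Finset.sum_range_succ, Finset.sum_range_one, e 0 (by omega),
    e 1 (by omega), e 2 (by omega)] at this
  simpa [M₀] using this

lemma M₁_left (hτ : StrictMono τ) (hτ01 : ∀ i, 0 < τ i ∧ τ i < 1) (hRP : R + 2 ≤ P) :
    ∃ q : ℝ[X], ∀ u, 0 ≤ u → u < tau₁ τ → M₁ P R τ u = u + u ^ 3 * q.eval u := by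
  obtain ⟨q, hq⟩ := marsden_coeff_left hτ hτ01 hRP (P - 1)
  refine ⟨C (-(P : ℝ)⁻¹) * q, fun u hu hu' => ?_⟩
  have := hq u hu hu'
  rw [Finset.sum_range_succ, Finset.sum_range_succ, Finset.sum_range_one, coeff_X_pow_mul',
    if_neg (by omega), coeff_X_pow_mul', if_pos le_rfl, coeff_X_pow_mul', if_pos (by omega),
    show P - 1 - (P - 2) = 1 by omega, show P - 1 - (P - 1) = 0 by omega,
    show P - (P - 1) = 1 by omega, Nat.choose_symm (by omega : 1 ≤ P), Nat.choose_one_right,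
    show ((X - C (tau₁ τ)) ^ 2 : ℝ[X]) = X * X - C (2 * tau₁ τ) * X + C (tau₁ τ ^ 2) by
      simp only [C_mul, C_pow]; rw [show (C 2 : ℝ[X]) = 2 from rfl]; ring] at this
  simp [-map_pow] at this
  have hP : (P : ℝ) ≠ 0 := by
    have : P ≠ 0 := by omega
    exact_mod_cast this
  rw [M₁, eval_mul, eval_C]
  field_simp
  linear_combination -this

lemma M₂_left (hτ : StrictMono τ) (hτ01 : ∀ i, 0 < τ i ∧ τ i < 1) (hRP : R + 2 ≤ P) :
    ∃ q : ℝ[X], ∀ u, 0 ≤ u → u < tau₁ τ → M₂ P R τ u = u ^ 2 / 2 + u ^ 3 * q.eval u := by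
  obtain ⟨q, hq⟩ := marsden_coeff_left hτ hτ01 hRP (P - 2)
  refine ⟨C (((P : ℝ) * (P - 1))⁻¹) * q, fun u hu hu' => ?_⟩
  have := hq u hu hu'
  rw [Finset.sum_range_succ, Finset.sum_range_succ, Finset.sum_range_one, coeff_X_pow_mul',
    if_neg (by omega), coeff_X_pow_mul', if_neg (by omega), coeff_X_pow_mul', if_pos le_rfl,
    show P - 2 - (P - 2) = 0 by omega, show P - (P - 2) = 2 by omega,
    Nat.choose_symm (by omega : 2 ≤ P), Nat.cast_choose_two,
    show ((X - C (tau₁ τ)) ^ 2 : ℝ[X]) = X * X - C (2 * tau₁ τ) * X + C (tau₁ τ ^ 2) by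
      simp only [C_mul, C_pow]; rw [show (C 2 : ℝ[X]) = 2 from rfl]; ring] at this
  simp [-map_pow] at this
  have hP : (P : ℝ) ≠ 0 := by
    have : P ≠ 0 := by omega
    exact_mod_cast this
  have hP1 : (P : ℝ) - 1 ≠ 0 := by
    have : (2 : ℝ) ≤ P := by exact_mod_cast (by omega : 2 ≤ P)
    linarith
  rw [M₂, eval_mul, eval_C]
  field_simp
  linear_combination 2 * this

end LeftEnd

/-! ### Derivatives at the left end from a polynomial representation -/

/-- The polynomial is known only to the right of `0`; differentiability of `w` on the line lets the
one-sided derivative decide at `0`. -/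
lemma deriv_eq_of_eq_poly {w : ℝ → ℝ} {q : ℝ[X]} {ε : ℝ} (hw : Differentiable ℝ w)
    (h : ∀ u, 0 ≤ u → u < ε → w u = q.eval u) {u : ℝ} (h0 : 0 ≤ u) (hu : u < ε) :
    deriv w u = (derivative q).eval u := by
  have hu' : u ∈ Ico 0 ε := ⟨h0, hu⟩
  have h1 := (hw u).hasDerivAt.hasDerivWithinAt (s := Ico 0 ε)
  have h2 : HasDerivWithinAt w ((derivative q).eval u) (Ico 0 ε) u :=
    (q.hasDerivAt u).hasDerivWithinAt.congr (fun x hx => h x hx.1 hx.2) (h u h0 hu)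
  exact (uniqueDiffOn_Ico 0 ε u hu').eq_deriv _ h1 h2

lemma jet_of_eq_poly {w : ℝ → ℝ} {a b c ε : ℝ} (hε : 0 < ε) (hw : ContDiff ℝ 2 w) {q : ℝ[X]}
    (h : ∀ u, 0 ≤ u → u < ε → w u = a + b * u + c * (u ^ 2 / 2) + u ^ 3 * q.eval u) :
    w 0 = a ∧ deriv w 0 = b ∧ deriv (deriv w) 0 = c := by
  set Q : ℝ[X] := C a + C b * X + C (c / 2) * X ^ 2 + X ^ 3 * q with hQ
  have hwQ : ∀ u, 0 ≤ u → u < ε → w u = Q.eval u := by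
    intro u h0 hu
    rw [h u h0 hu]
    simp [hQ]
    ring
  have hw1 : ContDiff ℝ 1 (deriv w) := by
    have : ContDiff ℝ (1 + 1) w := by simpa [one_add_one_eq_two] using hw
    exact (contDiff_succ_iff_deriv.1 this).2.2
  have hd := fun u => deriv_eq_of_eq_poly (u := u) (hw.differentiable (by norm_num)) hwQ
  refine ⟨by simp [h 0 le_rfl hε], ?_, ?_⟩
  · rw [hd 0 le_rfl hε]
    simp [hQ]
  · rw [deriv_eq_of_eq_poly (hw1.differentiable (by norm_num)) hd le_rfl hε]
    simp [hQ]
    ring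

end TwoPatch

namespace TwoPatch

open Filter Topology

/-! ### Functions of class `C²` on regular patches -/

section Patch

/-- By compactness and injectivity, the points of `K` away from `a` have a closed image that misses
`G a`. Hence all points of the patch near `G a` come from parameters near `a`, and a local inverse
describes the whole patch there. -/
lemma image_mem_nhdsWithin_of_injOn {E : Type*} [NormedAddCommGroup E] {K U : Set E} (hK : IsCompact K) {G : E → E}
    (hG : Continuous G) (hinj : InjOn G K) {a : E} (ha : a ∈ K) (hU : U ∈ 𝓝 a) :
    G '' (K ∩ U) ∈ 𝓝[G '' K] (G a) := by
  have hcl : IsClosed (G '' (K \ interior U)) :=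
    ((hK.diff isOpen_interior).image hG).isClosed
  have hna : G a ∉ G '' (K \ interior U) := by
    rintro ⟨b, ⟨hb, hb'⟩, h⟩
    exact hb' (hinj hb ha h ▸ mem_interior_iff_mem_nhds.2 hU)
  filter_upwards [self_mem_nhdsWithin, nhdsWithin_le_nhds (hcl.isOpen_compl.mem_nhds hna)]
  rintro _ ⟨b, hb, rfl⟩ h
  refine ⟨b, ⟨hb, ?_⟩, rfl⟩
  by_contra hbU
  exact h ⟨b, ⟨hb, fun h' => hbU (interior_subset h')⟩, rfl⟩

variable {E : Type*} [NormedAddCommGroup E] [NormedSpace ℝ E]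

/-- Composing `g` with the local inverse of `G` extends `f` to a full neighbourhood, also at
boundary points, so that derivatives within the patch become ordinary ones. -/
lemma exists_local_representative [CompleteSpace E] {K : Set E} (hK : IsCompact K) {G : E → E} (hG : ContDiff ℝ 2 G)
    (hinj : InjOn G K) {a : E} (ha : a ∈ K) {G' : E ≃L[ℝ] E} (hG' : HasFDerivAt G (G' : E →L[ℝ] E) a)
    {f g : E → ℝ} (hg : ContDiff ℝ 2 g) (hf : ∀ x ∈ K, f (G x) = g x) :
    ∃ A : E → ℝ, ContDiffAt ℝ 2 A (G a) ∧ f =ᶠ[𝓝[G '' K] (G a)] A ∧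
      ∀ᶠ x in 𝓝 a, A (G x) = g x := by
  have hGa : ContDiffAt ℝ 2 G a := hG.contDiffAt
  set h := hGa.localInverse hG' two_ne_zero with hh
  have hleft : ∀ᶠ x in 𝓝 a, h (G x) = x :=
    (hGa.hasStrictFDerivAt' hG' two_ne_zero).eventually_left_inverse
  refine ⟨g ∘ h, ?_, ?_, ?_⟩
  · exact hg.contDiffAt.comp _ (hGa.to_localInverse hG' two_ne_zero)
  · filter_upwards [image_mem_nhdsWithin_of_injOn hK hG.continuous hinj ha hleft]
    rintro _ ⟨b, ⟨hb, hb'⟩, rfl⟩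
    rw [hf b hb, Function.comp, show h (G b) = b from hb']
  · filter_upwards [hleft] with x hx
    rw [Function.comp, hx]

lemma contDiffOn_image [CompleteSpace E] {K : Set E} (hK : IsCompact K) {G : E → E} (hG : ContDiff ℝ 2 G)
    (hinj : InjOn G K) (hreg : ∀ a ∈ K, ∃ G' : E ≃L[ℝ] E, HasFDerivAt G (G' : E →L[ℝ] E) a)
    {f g : E → ℝ} (hg : ContDiff ℝ 2 g) (hf : ∀ x ∈ K, f (G x) = g x) :
    ContDiffOn ℝ 2 f (G '' K) := by
  rintro _ ⟨a, ha, rfl⟩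
  obtain ⟨G', hG'⟩ := hreg a ha
  obtain ⟨A, hA, hfA, -⟩ := exists_local_representative hK hG hinj ha hG' hg hf
  exact hA.contDiffWithinAt.congr_of_eventuallyEq hfA
    (hfA.eq_of_nhdsWithin (mem_image_of_mem G ha))

lemma uniqueDiffOn_image {K : Set E} (hK : UniqueDiffOn ℝ K) {G : E → E}
    (hreg : ∀ a ∈ K, ∃ G' : E ≃L[ℝ] E, HasFDerivAt G (G' : E →L[ℝ] E) a) :
    UniqueDiffOn ℝ (G '' K) := by
  refine hK.image (f' := fderiv ℝ G) (fun a ha => ?_) fun a ha => ?_ <;>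
    obtain ⟨G', hG'⟩ := hreg a ha
  · exact hG'.differentiableAt.hasFDerivAt.hasFDerivWithinAt
  · rw [hG'.fderiv]
    exact G'.surjective.denseRange

lemma contDiffAt_fderiv_of_two {F : Type*} [NormedAddCommGroup F] [NormedSpace ℝ F] {A : E → F}
    {x : E} (hA : ContDiffAt ℝ 2 A x) : ContDiffAt ℝ 1 (fderiv ℝ A) x :=
  hA.fderiv_right (by norm_num [one_add_one_eq_two])

/-- The chain rule up to second order for a function on a regular patch. -/
lemma patch_chain_rule [CompleteSpace E] {K : Set E} (hK : IsCompact K) (hKu : UniqueDiffOn ℝ K) {G : E → E}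
    (hG : ContDiff ℝ 2 G) (hinj : InjOn G K)
    (hreg : ∀ a ∈ K, ∃ G' : E ≃L[ℝ] E, HasFDerivAt G (G' : E →L[ℝ] E) a)
    {f g : E → ℝ} (hg : ContDiff ℝ 2 g) (hf : ∀ x ∈ K, f (G x) = g x) {a : E} (ha : a ∈ K) :
    let s := G '' K
    let L := fderivWithin ℝ f s (G a)
    let Q := fderivWithin ℝ (fderivWithin ℝ f s) s (G a)
    HasFDerivWithinAt (fderivWithin ℝ f s) Q s (G a) ∧ (∀ x y, Q x y = Q y x) ∧
      (∀ e, L (fderiv ℝ G a e) = fderiv ℝ g a e) ∧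
      ∀ e, Q (fderiv ℝ G a e) (fderiv ℝ G a e) + L (fderiv ℝ (fun x => fderiv ℝ G x e) a e) =
        fderiv ℝ (fun x => fderiv ℝ g x e) a e := by
  intro s L Q
  obtain ⟨G', hG'⟩ := hreg a ha
  obtain ⟨A, hA, hfA, hAg⟩ := exists_local_representative hK hG hinj ha hG' hg hf
  have hus : UniqueDiffOn ℝ s := uniqueDiffOn_image hKu hreg
  have hGa : G a ∈ s := mem_image_of_mem G ha
  have hAd : ∀ᶠ y in 𝓝 (G a), DifferentiableAt ℝ A y := by
    filter_upwards [hA.eventually (by simp)] with y hy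
    exact hy.differentiableAt (by norm_num)
  have hA1 : ContDiffAt ℝ 1 (fderiv ℝ A) (G a) := contDiffAt_fderiv_of_two hA
  have hA1d : DifferentiableAt ℝ (fderiv ℝ A) (G a) := hA1.differentiableAt (by norm_num)
  have hD : fderivWithin ℝ f s =ᶠ[𝓝[s] (G a)] fderiv ℝ A := by
    have h1 := Filter.EventuallyEq.fderivWithin' (𝕜 := ℝ) hfA (Subset.refl s)
    filter_upwards [h1, nhdsWithin_le_nhds hAd, self_mem_nhdsWithin] with y hy hy' hys
    rw [hy, hy'.fderivWithin (hus y hys)]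
  have hL : L = fderiv ℝ A (G a) := hD.eq_of_nhdsWithin hGa
  have hQ : Q = fderiv ℝ (fderiv ℝ A) (G a) := by
    rw [← hA1d.fderivWithin (hus _ hGa)]
    exact hD.fderivWithin_eq hL
  have hGd : Differentiable ℝ G := hG.differentiable (by norm_num)
  have hAG : ∀ᶠ x in 𝓝 a, ∀ e, fderiv ℝ g x e = fderiv ℝ A (G x) (fderiv ℝ G x e) := by
    filter_upwards [hAg.eventually_nhds, hG.continuous.continuousAt.eventually hAd] with x hx hx' e
    have hx2 : g =ᶠ[𝓝 x] A ∘ G := by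
      filter_upwards [hx] with y hy using hy.symm
    rw [hx2.fderiv_eq, fderiv_comp x hx' (hGd x)]
    rfl
  refine ⟨?_, ?_, ?_, ?_⟩
  · rw [hQ]
    exact hA1d.hasFDerivAt.hasFDerivWithinAt.congr_of_eventuallyEq hD hL
  · intro x y
    rw [hQ]
    exact hA.isSymmSndFDerivAt (by simp) x y
  · intro e
    rw [hL, hAG.self_of_nhds e]
  · intro e
    have h1 : HasFDerivAt (fun x => fderiv ℝ A (G x)) ((fderiv ℝ (fderiv ℝ A) (G a)).comp
        (fderiv ℝ G a)) a := hA1d.hasFDerivAt.comp a (hGd a).hasFDerivAt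
    have hG1 : Differentiable ℝ fun x => fderiv ℝ G x e := by
      have : ContDiff ℝ 1 (fderiv ℝ G) := hG.fderiv_right (by norm_num [one_add_one_eq_two])
      exact (this.clm_apply contDiff_const).differentiable (by norm_num)
    have h2 := h1.clm_apply (hG1 a).hasFDerivAt
    have h3 : (fun x => fderiv ℝ g x e) =ᶠ[𝓝 a] fun x => fderiv ℝ A (G x) (fderiv ℝ G x e) := by
      filter_upwards [hAG] with x hx using hx e
    rw [h3.fderiv_eq, h2.fderiv, hL, hQ]
    simp [add_comm]

end Patch

/-! ### Gluing two functions of class `C²` -/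

section Glue

variable {E F : Type*} [NormedAddCommGroup E] [NormedSpace ℝ E] [NormedAddCommGroup F]
  [NormedSpace ℝ F]

/-- Away from a closed set every linear map is a derivative within it, so only the sets that contain
`x` impose a condition. -/
lemma hasFDerivWithinAt_union {s t : Set E} (hs : IsClosed s) (ht : IsClosed t) {f : E → F}
    {f' : E → E →L[ℝ] F} (hfs : ∀ x ∈ s, HasFDerivWithinAt f (f' x) s x)
    (hft : ∀ x ∈ t, HasFDerivWithinAt f (f' x) t x) (x : E) :
    HasFDerivWithinAt f (f' x) (s ∪ t) x := by
  refine HasFDerivWithinAt.union ?_ ?_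
  · by_cases h : x ∈ s
    · exact hfs x h
    · exact .of_notMem_closure (by rwa [hs.closure_eq])
  · by_cases h : x ∈ t
    · exact hft x h
    · exact .of_notMem_closure (by rwa [ht.closure_eq])

lemma contDiffOn_union_succ {s t : Set E} (hs : IsClosed s) (ht : IsClosed t)
    (us : UniqueDiffOn ℝ s) (ut : UniqueDiffOn ℝ t) {n : ℕ} {f : E → F} {f' : E → E →L[ℝ] F}
    (hfs : ∀ x ∈ s, HasFDerivWithinAt f (f' x) s x)
    (hft : ∀ x ∈ t, HasFDerivWithinAt f (f' x) t x) (h : ContDiffOn ℝ n f' (s ∪ t)) :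
    ContDiffOn ℝ (n + 1) f (s ∪ t) := by
  have hu : UniqueDiffOn ℝ (s ∪ t) := by
    rintro x (hx | hx)
    · exact (us x hx).mono subset_union_left
    · exact (ut x hx).mono subset_union_right
  exact (contDiffOn_succ_iff_hasFDerivWithinAt_of_uniqueDiffOn hu).2
    ⟨fun h => absurd h (by simp), f', h, fun x _ => hasFDerivWithinAt_union hs ht hfs hft x⟩

/-- The derivatives on the two pieces agree on the overlap, so they glue to functions on the union;
closedness makes the glued second derivative continuous, and smoothness climbs back one order at a
time. -/
lemma contDiffOn_two_union {s t : Set E} (hs : IsClosed s) (ht : IsClosed t)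
    (us : UniqueDiffOn ℝ s) (ut : UniqueDiffOn ℝ t) {f : E → F} (hfs : ContDiffOn ℝ 2 f s)
    (hft : ContDiffOn ℝ 2 f t)
    (h1 : ∀ x ∈ s ∩ t, fderivWithin ℝ f s x = fderivWithin ℝ f t x)
    (h2 : ∀ x ∈ s ∩ t, fderivWithin ℝ (fderivWithin ℝ f s) s x =
      fderivWithin ℝ (fderivWithin ℝ f t) t x) : ContDiffOn ℝ 2 f (s ∪ t) := by
  classical
  have glue : ∀ {X : Type _} (a b : E → X), (∀ x ∈ s ∩ t, a x = b x) →
      EqOn (s.piecewise a b) b t := by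
    intro X a b h x hx
    by_cases hxs : x ∈ s
    · rw [piecewise_eq_of_mem _ _ _ hxs, h x ⟨hxs, hx⟩]
    · rw [piecewise_eq_of_notMem _ _ _ hxs]
  set f' := s.piecewise (fderivWithin ℝ f s) (fderivWithin ℝ f t)
  set f'' := s.piecewise (fderivWithin ℝ (fderivWithin ℝ f s) s)
    (fderivWithin ℝ (fderivWithin ℝ f t) t)
  have es : EqOn f' (fderivWithin ℝ f s) s := piecewise_eqOn _ _ _
  have et : EqOn f' (fderivWithin ℝ f t) t := glue _ _ h1
  have es2 : EqOn f'' (fderivWithin ℝ (fderivWithin ℝ f s) s) s := piecewise_eqOn _ _ _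
  have et2 : EqOn f'' (fderivWithin ℝ (fderivWithin ℝ f t) t) t := glue _ _ h2
  have hfs1 : ContDiffOn ℝ 1 (fderivWithin ℝ f s) s :=
    hfs.fderivWithin us (by norm_num [one_add_one_eq_two])
  have hft1 : ContDiffOn ℝ 1 (fderivWithin ℝ f t) t :=
    hft.fderivWithin ut (by norm_num [one_add_one_eq_two])
  have hc : ContDiffOn ℝ (0 : ℕ) f'' (s ∪ t) := by
    refine contDiffOn_zero.2 (ContinuousOn.union_of_isClosed ?_ ?_ hs ht)
    · exact (hfs1.continuousOn_fderivWithin us (by norm_num)).congr es2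
    · exact (hft1.continuousOn_fderivWithin ut (by norm_num)).congr et2
  have h1' : ContDiffOn ℝ (1 : ℕ) f' (s ∪ t) := by
    have := contDiffOn_union_succ hs ht us ut (f := f') (f' := f'') (n := 0)
      (fun x hx => ?_) (fun x hx => ?_) hc
    · simpa using this
    · rw [es2 hx]
      exact ((hfs1.differentiableOn (by norm_num)) x hx).hasFDerivWithinAt.congr es (es hx)
    · rw [et2 hx]
      exact ((hft1.differentiableOn (by norm_num)) x hx).hasFDerivWithinAt.congr et (et hx)
  have := contDiffOn_union_succ hs ht us ut (f := f) (f' := f') (n := 1)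
      (fun x hx => ?_) (fun x hx => ?_) h1'
  · simpa [one_add_one_eq_two] using this
  · rw [es hx]
    exact ((hfs.differentiableOn (by norm_num)) x hx).hasFDerivWithinAt
  · rw [et hx]
    exact ((hft.differentiableOn (by norm_num)) x hx).hasFDerivWithinAt

end Glue

end TwoPatch

namespace TwoPatch

open Filter Topology

/-! ### Partial derivatives on the square and the algebra of the interface -/

section Partial

variable {E : Type*} [NormedAddCommGroup E] [NormedSpace ℝ E] {g G : ℝ × ℝ → E}

lemma hasDerivAt_fst (hG : Differentiable ℝ G) (u v : ℝ) :
    HasDerivAt (fun s => G (s, v)) (fderiv ℝ G (u, v) (1, 0)) u :=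
  (hG (u, v)).hasFDerivAt.comp_hasDerivAt u ((hasDerivAt_id u).prodMk (hasDerivAt_const u v))

lemma hasDerivAt_snd (hG : Differentiable ℝ G) (u v : ℝ) :
    HasDerivAt (fun s => G (u, s)) (fderiv ℝ G (u, v) (0, 1)) v :=
  (hG (u, v)).hasFDerivAt.comp_hasDerivAt v ((hasDerivAt_const v u).prodMk (hasDerivAt_id v))

lemma Du_eq (hG : Differentiable ℝ G) (h : ∀ x ∈ unitSquare, g x = G x) :
    ∀ x ∈ unitSquare, Du g x = fderiv ℝ G x (1, 0) := by
  rintro ⟨u, v⟩ ⟨hu, hv⟩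
  exact ((hasDerivAt_fst hG u v).hasDerivWithinAt.congr (fun s hs => h (s, v) ⟨hs, hv⟩)
    (h (u, v) ⟨hu, hv⟩)).derivWithin (uniqueDiffOn_Icc zero_lt_one u hu)

lemma Dv_eq (hG : Differentiable ℝ G) (h : ∀ x ∈ unitSquare, g x = G x) :
    ∀ x ∈ unitSquare, Dv g x = fderiv ℝ G x (0, 1) := by
  rintro ⟨u, v⟩ ⟨hu, hv⟩
  exact ((hasDerivAt_snd hG u v).hasDerivWithinAt.congr (fun s hs => h (u, s) ⟨hu, hs⟩)
    (h (u, v) ⟨hu, hv⟩)).derivWithin (uniqueDiffOn_Icc zero_lt_one v hv)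

lemma differentiable_fderiv_apply (hG : ContDiff ℝ 2 G) (e : ℝ × ℝ) :
    Differentiable ℝ fun x => fderiv ℝ G x e := by
  have : ContDiff ℝ 1 (fderiv ℝ G) := hG.fderiv_right (by norm_num [one_add_one_eq_two])
  exact (this.clm_apply contDiff_const).differentiable (by norm_num)

end Partial

lemma exists_equiv_of_det₂_ne_zero {L : ℝ × ℝ →L[ℝ] ℝ × ℝ} (h : det₂ (L (1, 0)) (L (0, 1)) ≠ 0) :
    ∃ L' : (ℝ × ℝ) ≃L[ℝ] ℝ × ℝ, (L' : ℝ × ℝ →L[ℝ] ℝ × ℝ) = L := by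
  have hinj : Function.Injective (L : ℝ × ℝ →ₗ[ℝ] ℝ × ℝ) := by
    refine (injective_iff_map_eq_zero _).2 ?_
    rintro ⟨a, b⟩ hab
    have hab' : L (a, b) = 0 := hab
    have e : ((a, b) : ℝ × ℝ) = a • (1, 0) + b • (0, 1) := by simp
    rw [e, map_add, map_smul, map_smul] at hab'
    have e1 := congrArg Prod.fst hab'
    have e2 := congrArg Prod.snd hab'
    simp only [Prod.fst_add, Prod.smul_fst, Prod.snd_add, Prod.smul_snd, smul_eq_mul,
      Prod.fst_zero, Prod.snd_zero] at e1 e2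
    unfold det₂ at h
    have ha : a = 0 := by
      refine (mul_eq_zero.1 ?_).resolve_right h
      linear_combination (L (0, 1)).2 * e1 - (L (0, 1)).1 * e2
    have hb : b = 0 := by
      refine (mul_eq_zero.1 ?_).resolve_right h
      linear_combination (L (1, 0)).1 * e2 - (L (1, 0)).2 * e1
    rw [ha, hb]; rfl
  refine ⟨(LinearEquiv.ofInjectiveEndo _ hinj).toContinuousLinearEquiv, ?_⟩
  ext <;> rfl

/-- The algebra behind the `G²` condition: if the bilinear forms `QL`, `QR` have the second-order
data prescribed along the interface, then they agree. -/
lemma bilin_eq_of_interface {L : ℝ × ℝ →L[ℝ] ℝ} {QL QR : ℝ × ℝ →L[ℝ] ℝ × ℝ →L[ℝ] ℝ}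
    {eL eR w DuuL DuuR Duv Dvv : ℝ × ℝ}
    {aL aR bL bR aL' bL' g₀' g₀'' g₁ g₁' g₂ : ℝ} (haL : aL ≠ 0) (haR : aR ≠ 0)
    (hspan : ∀ y : ℝ × ℝ, ∃ a b : ℝ, y = a • eL + b • w)
    (symL : ∀ x y, QL x y = QL y x) (symR : ∀ x y, QR x y = QR y x) (hw : QL w = QR w)
    (hLw : L w = g₀') (hLe : L eL = aL * g₁ + bL * g₀')
    (hww : QL w w + L Dvv = g₀'')
    (hwe : QL w eL + L Duv = aL' * g₁ + aL * g₁' + (bL' * g₀' + bL * g₀''))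
    (hLL : QL eL eL + L DuuL = bL ^ 2 * g₀'' + 2 * aL * bL * g₁' + aL ^ 2 * g₂)
    (hRR : QR eR eR + L DuuR = bR ^ 2 * g₀'' + 2 * aR * bR * g₁' + aR ^ 2 * g₂)
    (h1 : aR • eL - aL • eR + (aL * bR - aR * bL) • w = 0)
    (h2 : aL • (aL ^ 2 • DuuR - (aR ^ 2 • DuuL + (2 * aR * (aL * bR - aR * bL)) • Duv +
        (aL * bR - aR * bL) ^ 2 • Dvv)) + (2 * aL' * aR * (aL * bR - aR * bL)) • eL +
        (2 * (aL * bL' - aL' * bL) * aR * (aL * bR - aR * bL)) • w = 0) : QL = QR := by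
  have h1' : aL • eR = aR • eL + (aL * bR - aR * bL) • w := by
    rw [← sub_eq_zero, ← neg_eq_zero, ← h1]; abel
  have hR : aL ^ 2 * QR eR eR = aR ^ 2 * QR eL eL + 2 * aR * (aL * bR - aR * bL) * QL w eL +
      (aL * bR - aR * bL) ^ 2 * QL w w := by
    have : QR (aL • eR) (aL • eR) = aL ^ 2 * QR eR eR := by
      simp only [map_smul, smul_apply, smul_eq_mul]; ring
    rw [← this, h1', hw]
    simp only [map_add, map_smul, add_apply, smul_apply,
      smul_eq_mul, symR eL w]
    ring
  -- Applying the common gradient `L` to the `G²` relation eliminates the second derivatives of the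
  -- geometry; with `hR`, only the difference of the two Hessians in the direction `eL` survives.
  have h2' := congrArg L h2
  simp only [map_add, map_sub, map_smul, smul_eq_mul, map_zero] at h2'
  have key : aL * aR ^ 2 * (QR eL eL - QL eL eL) = 0 := by
    linear_combination -aL * hR + aL ^ 3 * hRR - h2' - aL * aR ^ 2 * hLL -
      2 * aL * aR * (aL * bR - aR * bL) * hwe - aL * (aL * bR - aR * bL) ^ 2 * hww +
      (2 * aL' * aR * (aL * bR - aR * bL)) * hLe +
      (2 * (aL * bL' - aL' * bL) * aR * (aL * bR - aR * bL)) * hLw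
  have hee : QR eL eL = QL eL eL :=
    sub_eq_zero.1 ((mul_eq_zero.1 key).resolve_left (mul_ne_zero haL (pow_ne_zero 2 haR)))
  have hwx : ∀ x, QL w x = QR w x := fun x => by rw [hw]
  refine ContinuousLinearMap.ext fun x => ContinuousLinearMap.ext fun y => ?_
  obtain ⟨a, b, rfl⟩ := hspan x
  obtain ⟨c, d, rfl⟩ := hspan y
  simp only [map_add, map_smul, add_apply, smul_apply,
    smul_eq_mul]
  rw [hee, hwx, hwx, symL eL w, symR eL w, hwx]

lemma isCompact_unitSquare : IsCompact unitSquare := isCompact_Icc.prod isCompact_Icc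

lemma uniqueDiffOn_unitSquare : UniqueDiffOn ℝ unitSquare :=
  (uniqueDiffOn_Icc zero_lt_one).prod (uniqueDiffOn_Icc zero_lt_one)

lemma zero_mk_mem_unitSquare {v : ℝ} (hv : v ∈ Icc (0 : ℝ) 1) : ((0 : ℝ), v) ∈ unitSquare :=
  ⟨⟨le_rfl, zero_le_one⟩, hv⟩

lemma IsDerivOnI.eq {g g₁ g₂ : ℝ → ℝ} (h₁ : IsDerivOnI g g₁) (h₂ : IsDerivOnI g g₂) {v : ℝ}
    (hv : v ∈ Icc (0 : ℝ) 1) : g₁ v = g₂ v :=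
  (uniqueDiffOn_Icc zero_lt_one v hv).eq_deriv _ (h₁ v hv) (h₂ v hv)

/-! ### Smoothness across the interface from the jets of the pullbacks -/

section Smooth

variable {p r k : ℕ} {τ : Fin k → ℝ} {F : Side → ℝ × ℝ → ℝ × ℝ} {α β : Side → ℝ[X]}

lemma exists_contDiff_ext (hr : 2 ≤ r) (hτ : StrictMono τ) (hτ01 : ∀ i, 0 < τ i ∧ τ i < 1)
    {E : Type*} [NormedAddCommGroup E] [NormedSpace ℝ E]
    (c : Fin (numB p r k) → Fin (numB p r k) → E) :
    ∃ G : ℝ × ℝ → E, ContDiff ℝ 2 G ∧ ∀ x ∈ unitSquare, tensorSpline p r τ c x = G x := by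
  obtain ⟨b, hb⟩ := exists_bspline_ext (P := p) (R := r) hτ hτ01
  have hb2 : ∀ i : Fin (numB p r k), ContDiff ℝ 2 (b i) := fun i =>
    contDiff_of_mem_truncSpace (n := 2) hr (hb i i.2).1
  refine ⟨fun x => ∑ i : Fin (numB p r k), ∑ j : Fin (numB p r k), (b i x.1 * b j x.2) • c i j,
    ?_, ?_⟩
  · refine ContDiff.sum fun i _ => ContDiff.sum fun j _ => ContDiff.smul (ContDiff.mul ?_ ?_)
      contDiff_const
    · exact (hb2 i).comp contDiff_fst
    · exact (hb2 j).comp contDiff_snd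
  · intro x hx
    refine Finset.sum_congr rfl fun i _ => Finset.sum_congr rfl fun j _ => ?_
    rw [(hb i i.2).2 _ hx.1, (hb j j.2).2 _ hx.2]

/-- The second-order jets along the interface decide about `C²`-smoothness. -/
theorem mem_smoothSpace_of_jets (hr : 2 ≤ r) (hτ : StrictMono τ) (hτ01 : ∀ i, 0 < τ i ∧ τ i < 1)
    (hF : IsTwoPatch p r τ F) (hbl : IsBilinearLike F α β) {φ : Ω F → ℝ} {gt : Side → ℝ × ℝ → ℝ}
    (hgt : ∀ S, ContDiff ℝ 2 (gt S)) (hpull : ∀ S (x : unitSquare), pull F S φ x = gt S x)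
    {g₀ g₀' g₀'' g₁ g₁' g₂ : ℝ → ℝ} (hd0 : IsDerivOnI g₀ g₀') (hd0' : IsDerivOnI g₀' g₀'')
    (hd1 : IsDerivOnI g₁ g₁') {ε : ℝ} (hε : 0 < ε)
    (hjet : ∀ S, ∀ v ∈ Icc (0 : ℝ) 1, ∃ q : ℝ[X], ∀ u, 0 ≤ u → u < ε → gt S (u, v) =
      g₀ v + ((α S).eval v * g₁ v + (β S).eval v * g₀' v) * u +
        (((β S).eval v) ^ 2 * g₀'' v + 2 * (α S).eval v * (β S).eval v * g₁' v +
          ((α S).eval v) ^ 2 * g₂ v) * (u ^ 2 / 2) + u ^ 3 * q.eval u) :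
    φ ∈ smoothSpace F := by
  classical
  have hGex : ∀ S, ∃ G : ℝ × ℝ → ℝ × ℝ, ContDiff ℝ 2 G ∧ ∀ x ∈ unitSquare, F S x = G x := by
    intro S
    obtain ⟨c, hc⟩ := hF.spline S
    obtain ⟨G, hG, hG'⟩ := exists_contDiff_ext hr hτ hτ01 c
    exact ⟨G, hG, fun x hx => (hc x hx).trans (hG' x hx)⟩
  choose G hG hFG using hGex
  have hGd : ∀ S, Differentiable ℝ (G S) := fun S => (hG S).differentiable (by norm_num)
  have hgd : ∀ S, Differentiable ℝ (gt S) := fun S => (hgt S).differentiable (by norm_num)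
  have hDu := fun S => Du_eq (hGd S) (hFG S)
  have hDv := fun S => Dv_eq (hGd S) (hFG S)
  have hG1 := fun S => differentiable_fderiv_apply (hG S)
  have hDuu := fun S => Du_eq (hG1 S (1, 0)) (hDu S)
  have hDuv := fun S => Dv_eq (hG1 S (1, 0)) (hDu S)
  have hDvv := fun S => Dv_eq (hG1 S (0, 1)) (hDv S)
  have hinj : ∀ S, InjOn (G S) unitSquare := fun S => (hF.inj S).congr (hFG S)
  have hreg : ∀ S, ∀ a ∈ unitSquare, ∃ G' : (ℝ × ℝ) ≃L[ℝ] ℝ × ℝ,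
      HasFDerivAt (G S) (G' : ℝ × ℝ →L[ℝ] ℝ × ℝ) a := by
    intro S a ha
    have h := hF.regular S a ha
    rw [hDu S a ha, hDv S a ha] at h
    obtain ⟨L', hL'⟩ := exists_equiv_of_det₂_ne_zero h
    exact ⟨L', hL' ▸ (hGd S a).hasFDerivAt⟩
  have himg : ∀ S, F S '' unitSquare = G S '' unitSquare := fun S => image_congr (hFG S)
  set f : ℝ × ℝ → ℝ := fun y => if h : y ∈ Ω F then φ ⟨y, h⟩ else 0 with hf
  have hfG : ∀ S, ∀ x ∈ unitSquare, f (G S x) = gt S x := by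
    intro S x hx
    have hmem : F S x ∈ Ω F := mem_iUnion.2 ⟨S, mem_image_of_mem _ hx⟩
    rw [← hFG S x hx, ← hpull S ⟨x, hx⟩, hf]
    exact dif_pos hmem
  have hΩ : Ω F = G .L '' unitSquare ∪ G .R '' unitSquare := by
    rw [← himg, ← himg]
    ext y
    simp only [Ω, mem_iUnion, mem_union]
    exact ⟨fun ⟨S, h⟩ => by cases S <;> tauto, fun h => h.elim (fun h => ⟨_, h⟩) fun h => ⟨_, h⟩⟩
  have hint : G .L '' unitSquare ∩ G .R '' unitSquare = (fun v : ℝ => G .L (0, v)) '' Icc 0 1 := by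
    rw [← himg, ← himg, hF.interface]
    exact image_congr fun v hv => hFG .L _ (zero_mk_mem_unitSquare hv)
  have hedge : ∀ v ∈ Icc (0 : ℝ) 1, G .L (0, v) = G .R (0, v) := by
    intro v hv
    rw [← hFG .L _ (zero_mk_mem_unitSquare hv), ← hFG .R _ (zero_mk_mem_unitSquare hv),
      hF.edge v hv]
  have hclosed : ∀ S, IsClosed (G S '' unitSquare) := fun S =>
    (isCompact_unitSquare.image (hG S).continuous).isClosed
  have huniq : ∀ S, UniqueDiffOn ℝ (G S '' unitSquare) := fun S =>
    uniqueDiffOn_image uniqueDiffOn_unitSquare (hreg S)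
  have hpatch : ∀ S, ContDiffOn ℝ 2 f (G S '' unitSquare) := fun S =>
    contDiffOn_image isCompact_unitSquare (hG S) (hinj S) (hreg S) (hgt S) (hfG S)
  set D := fun S => fderivWithin ℝ f (G S '' unitSquare) with hD
  set Q := fun S => fderivWithin ℝ (D S) (G S '' unitSquare) with hQ
  have chain := fun S v (hv : v ∈ Icc (0 : ℝ) 1) => patch_chain_rule isCompact_unitSquare
    uniqueDiffOn_unitSquare (hG S) (hinj S) (hreg S) (hgt S) (hfG S) (zero_mk_mem_unitSquare hv)
  have hα : ∀ v ∈ Icc (0 : ℝ) 1, (α .L).eval v ≠ 0 ∧ (α .R).eval v ≠ 0 := fun v hv =>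
    mul_ne_zero_iff.1 (hbl.sign v hv).ne
  have hI : UniqueDiffOn ℝ (Icc (0 : ℝ) 1) := uniqueDiffOn_Icc zero_lt_one
  -- the jets of the pullbacks
  have jets : ∀ S, ∀ v ∈ Icc (0 : ℝ) 1, gt S (0, v) = g₀ v ∧
      fderiv ℝ (gt S) (0, v) (1, 0) = (α S).eval v * g₁ v + (β S).eval v * g₀' v ∧
      fderiv ℝ (fun x => fderiv ℝ (gt S) x (1, 0)) (0, v) (1, 0) =
        ((β S).eval v) ^ 2 * g₀'' v + 2 * (α S).eval v * (β S).eval v * g₁' v +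
          ((α S).eval v) ^ 2 * g₂ v := by
    intro S v hv
    obtain ⟨q, hq⟩ := hjet S v hv
    have hc : ContDiff ℝ 2 fun u => gt S (u, v) :=
      (hgt S).comp (contDiff_id.prodMk contDiff_const)
    have e1 : deriv (fun u => gt S (u, v)) = fun u => fderiv ℝ (gt S) (u, v) (1, 0) :=
      funext fun u => (hasDerivAt_fst (hgd S) u v).deriv
    have e2 := (hasDerivAt_fst (differentiable_fderiv_apply (hgt S) (1, 0)) 0 v).deriv
    have := jet_of_eq_poly hε hc hq
    rw [e1, e2] at this
    exact this
  -- the tangent vector of the interface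
  have hw : ∀ v ∈ Icc (0 : ℝ) 1,
      fderiv ℝ (G .R) (0, v) (0, 1) = fderiv ℝ (G .L) (0, v) (0, 1) := by
    intro v hv
    refine (hI v hv).eq_deriv _ (hasDerivAt_snd (hGd .R) 0 v).hasDerivWithinAt ?_
    exact (hasDerivAt_snd (hGd .L) 0 v).hasDerivWithinAt.congr (fun s hs => (hedge s hs).symm)
      (hedge v hv).symm
  have hDw : ∀ S, ∀ v ∈ Icc (0 : ℝ) 1,
      D S (G S (0, v)) (fderiv ℝ (G S) (0, v) (0, 1)) = g₀' v := by
    intro S v hv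
    refine ((chain S v hv).2.2.1 (0, 1)).trans ?_
    refine (hI v hv).eq_deriv _ (hasDerivAt_snd (hgd S) 0 v).hasDerivWithinAt ?_
    exact (hd0 v hv).congr (fun s hs => (jets S s hs).1) (jets S v hv).1
  have hDe : ∀ S, ∀ v ∈ Icc (0 : ℝ) 1, D S (G S (0, v)) (fderiv ℝ (G S) (0, v) (1, 0)) =
      (α S).eval v * g₁ v + (β S).eval v * g₀' v := fun S v hv =>
    ((chain S v hv).2.2.1 (1, 0)).trans (jets S v hv).2.1
  -- every vector is a combination of the two partial derivatives
  have hspan : ∀ v ∈ Icc (0 : ℝ) 1, ∀ y : ℝ × ℝ, ∃ a b : ℝ,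
      y = a • fderiv ℝ (G .L) (0, v) (1, 0) + b • fderiv ℝ (G .L) (0, v) (0, 1) := by
    intro v hv y
    obtain ⟨G', hG'⟩ := hreg .L _ (zero_mk_mem_unitSquare hv)
    obtain ⟨⟨a, b⟩, hab⟩ := G'.surjective y
    refine ⟨a, b, ?_⟩
    rw [hG'.fderiv, ← map_smul, ← map_smul, ← map_add, ← hab]
    simp
  have hg1 : ∀ v ∈ Icc (0 : ℝ) 1, (α .R).eval v • fderiv ℝ (G .L) (0, v) (1, 0) -
      (α .L).eval v • fderiv ℝ (G .R) (0, v) (1, 0) +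
      ((α .L).eval v * (β .R).eval v - (α .R).eval v * (β .L).eval v) •
        fderiv ℝ (G .L) (0, v) (0, 1) = 0 := by
    intro v hv
    have h := hbl.g1 v hv
    have hz := zero_mk_mem_unitSquare hv
    rw [hDu .L _ hz, hDu .R _ hz, hDv .L _ hz] at h
    simpa [betaPoly] using h
  -- The tangential derivative is `g₀'` on both sides. In the `G¹` relation the `β` terms cancel,
  -- which gives equality in the transversal direction after division by `α .R`.
  have hD_eq : ∀ v ∈ Icc (0 : ℝ) 1, D .L (G .L (0, v)) = D .R (G .R (0, v)) := by
    intro v hv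
    have ew := hDw .R v hv
    rw [hw v hv] at ew
    have ee : D .L (G .L (0, v)) (fderiv ℝ (G .L) (0, v) (1, 0)) =
        D .R (G .R (0, v)) (fderiv ℝ (G .L) (0, v) (1, 0)) := by
      have h := congrArg (D .R (G .R (0, v))) (hg1 v hv)
      simp only [map_add, map_sub, map_smul, smul_eq_mul, map_zero] at h
      rw [hDe .R v hv, ew] at h
      rw [hDe .L v hv]
      refine mul_left_cancel₀ (hα v hv).2 ?_
      linear_combination -h
    refine ContinuousLinearMap.ext fun y => ?_
    obtain ⟨a, b, rfl⟩ := hspan v hv y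
    simp only [map_add, map_smul]
    rw [ee, ew, hDw .L v hv]
  -- differentiate along the interface
  have hDd : ∀ S, ∀ v ∈ Icc (0 : ℝ) 1, HasDerivWithinAt (fun s => D S (G S (0, s)))
      (Q S (G S (0, v)) (fderiv ℝ (G S) (0, v) (0, 1))) (Icc 0 1) v := by
    intro S v hv
    exact (chain S v hv).1.comp_hasDerivWithinAt v (hasDerivAt_snd (hGd S) 0 v).hasDerivWithinAt
      fun s hs => mem_image_of_mem _ (zero_mk_mem_unitSquare hs)
  -- Both sides are derivatives in `v` of the same gradient along the edge.
  have hQw : ∀ v ∈ Icc (0 : ℝ) 1, Q .L (G .L (0, v)) (fderiv ℝ (G .L) (0, v) (0, 1)) =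
      Q .R (G .R (0, v)) (fderiv ℝ (G .L) (0, v) (0, 1)) := by
    intro v hv
    rw [← hw v hv]
    refine (hI v hv).eq_deriv _ ?_ (hDd .R v hv)
    rw [hw v hv]
    exact (hDd .L v hv).congr (fun s hs => (hD_eq s hs).symm) (hD_eq v hv).symm
  have hQ_eq : ∀ v ∈ Icc (0 : ℝ) 1, Q .L (G .L (0, v)) = Q .R (G .R (0, v)) := by
    intro v hv
    have hz := zero_mk_mem_unitSquare hv
    -- This and `hwe` come from differentiating `hDw` and `hDe` in `v` by the product rule.
    have hww : Q .L (G .L (0, v)) (fderiv ℝ (G .L) (0, v) (0, 1))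
        (fderiv ℝ (G .L) (0, v) (0, 1)) + D .L (G .L (0, v))
        (fderiv ℝ (fun x => fderiv ℝ (G .L) x (0, 1)) (0, v) (0, 1)) = g₀'' v := by
      refine (hI v hv).eq_deriv _ ((hDd .L v hv).clm_apply
        (hasDerivAt_snd (hG1 .L (0, 1)) 0 v).hasDerivWithinAt) ?_
      exact (hd0' v hv).congr (fun s hs => hDw .L s hs) (hDw .L v hv)
    have hwe : Q .L (G .L (0, v)) (fderiv ℝ (G .L) (0, v) (0, 1))
        (fderiv ℝ (G .L) (0, v) (1, 0)) + D .L (G .L (0, v))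
        (fderiv ℝ (fun x => fderiv ℝ (G .L) x (1, 0)) (0, v) (0, 1)) =
        (derivative (α .L)).eval v * g₁ v + (α .L).eval v * g₁' v +
          ((derivative (β .L)).eval v * g₀' v + (β .L).eval v * g₀'' v) := by
      refine (hI v hv).eq_deriv _ ((hDd .L v hv).clm_apply
        (hasDerivAt_snd (hG1 .L (1, 0)) 0 v).hasDerivWithinAt) ?_
      exact ((((α .L).hasDerivAt v).hasDerivWithinAt.fun_mul (hd1 v hv)).fun_add
        (((β .L).hasDerivAt v).hasDerivWithinAt.fun_mul (hd0' v hv))).congr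
        (fun s hs => hDe .L s hs) (hDe .L v hv)
    have hLL := ((chain .L v hv).2.2.2 (1, 0)).trans (jets .L v hv).2.2
    have hRR := ((chain .R v hv).2.2.2 (1, 0)).trans (jets .R v hv).2.2
    have hRR' : Q .R (G .R (0, v)) (fderiv ℝ (G .R) (0, v) (1, 0))
        (fderiv ℝ (G .R) (0, v) (1, 0)) + D .L (G .L (0, v))
        (fderiv ℝ (fun x => fderiv ℝ (G .R) x (1, 0)) (0, v) (1, 0)) =
        ((β .R).eval v) ^ 2 * g₀'' v + 2 * (α .R).eval v * (β .R).eval v * g₁' v +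
          ((α .R).eval v) ^ 2 * g₂ v := by
      rw [hD_eq v hv]; exact hRR
    have h2 := hbl.g2 v hv
    rw [Z, hDuu .R _ hz, hDuu .L _ hz, hDuv .L _ hz, hDvv .L _ hz, hDu .L _ hz, hDv .L _ hz] at h2
    refine bilin_eq_of_interface (hα v hv).1 (hα v hv).2 (hspan v hv) (chain .L v hv).2.1
      (chain .R v hv).2.1 (hQw v hv) (hDw .L v hv) (hDe .L v hv) hww hwe hLL hRR' (hg1 v hv) ?_
    simpa [betaPoly, etaPoly, thetaPoly] using h2
  refine ⟨f, ?_, fun x => dif_pos x.2⟩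
  rw [hΩ]
  refine contDiffOn_two_union (hclosed _) (hclosed _) (huniq _) (huniq _) (hpatch _) (hpatch _)
    ?_ ?_
  · intro x hx
    rw [hint] at hx
    obtain ⟨v, hv, rfl⟩ := hx
    have := hD_eq v hv
    rwa [← hedge v hv] at this
  · intro x hx
    rw [hint] at hx
    obtain ⟨v, hv, rfl⟩ := hx
    have := hQ_eq v hv
    rwa [← hedge v hv] at this

end Smooth

end TwoPatch

namespace TwoPatch

/-! ### Dimensions through linear parametrizations of the pullbacks -/

section Dimension

variable {p r k : ℕ} {τ : Fin k → ℝ} {F : Side → ℝ × ℝ → ℝ × ℝ} {α β : Side → ℝ[X]}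

/-- Functions on the domain that are given by a linear parametrization of their pullbacks. -/
lemma finrank_of_parametrization {V : Type*} [AddCommGroup V] [Module ℝ V] [FiniteDimensional ℝ V]
    (hF : IsTwoPatch p r τ F) (E : Side → ℝ × ℝ → V →ₗ[ℝ] ℝ)
    (hcompat : ∀ v ∈ Icc (0 : ℝ) 1, E .L (0, v) = E .R (0, v))
    (hinj : ∀ c, (∀ S, ∀ x ∈ unitSquare, E S x c = 0) → c = 0) {W : Submodule ℝ (Ω F → ℝ)}
    (hW : ∀ φ, φ ∈ W ↔ ∃ c, ∀ S, ∀ x : unitSquare, pull F S φ x = E S x c) :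
    FiniteDimensional ℝ W ∧ Module.finrank ℝ W = Module.finrank ℝ V := by
  -- The patches meet only in the edge, and injectivity gives a common point the same parameter `(0,
  -- v)` on both sides; compatibility of `E` there makes the glued function well defined.
  have hLR : ∀ x ∈ unitSquare, ∀ y ∈ unitSquare, F .L x = F .R y → E .L x = E .R y := by
    intro x hx y hy h
    have hmem : F .L x ∈ F .L '' unitSquare ∩ F .R '' unitSquare :=
      ⟨mem_image_of_mem _ hx, h ▸ mem_image_of_mem _ hy⟩
    rw [hF.interface] at hmem
    obtain ⟨v, hv, hvx⟩ := hmem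
    have hz := zero_mk_mem_unitSquare hv
    rw [← hF.inj .L hz hx hvx,
      ← hF.inj .R hz hy (by rw [← hF.edge v hv, ← h]; exact hvx), hcompat v hv]
  have huniq : ∀ S S', ∀ x ∈ unitSquare, ∀ y ∈ unitSquare, F S x = F S' y → E S x = E S' y := by
    rintro (_ | _) (_ | _) x hx y hy h
    · rw [hF.inj _ hx hy h]
    · exact hLR x hx y hy h
    · exact (hLR y hy x hx h.symm).symm
    · rw [hF.inj _ hx hy h]
  have hex : ∀ y : Ω F, ∃ S, ∃ x : unitSquare, F S x = y := by
    rintro ⟨y, hy⟩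
    obtain ⟨S, x, hx, rfl⟩ := mem_iUnion.1 hy
    exact ⟨S, ⟨x, hx⟩, rfl⟩
  choose S x hSx using hex
  set Φ : V →ₗ[ℝ] (Ω F → ℝ) := LinearMap.pi fun y => E (S y) (x y)
  have hΦ : ∀ c S' (x' : unitSquare), pull F S' (Φ c) x' = E S' x' c := by
    intro c S' x'
    exact congrArg (fun l : V →ₗ[ℝ] ℝ => l c) (huniq _ _ _ (x _).2 _ x'.2 (hSx _))
  have hWΦ : W = LinearMap.range Φ := by
    ext φ
    rw [hW, LinearMap.mem_range]
    refine exists_congr fun c => ⟨fun h => funext fun y => ?_, ?_⟩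
    · rw [← show pull F (S y) φ (x y) = φ y from congrArg φ (Subtype.ext (hSx y)), h]
      rfl
    · rintro rfl
      exact hΦ c
  have hker : Function.Injective Φ := by
    refine (injective_iff_map_eq_zero Φ).2 fun c hc => hinj c fun S' x' hx' => ?_
    rw [← hΦ c S' ⟨x', hx'⟩, hc]
    rfl
  subst hWΦ
  exact ⟨inferInstance, LinearMap.finrank_range_of_inj hker⟩

/-! ### Tensor-product splines -/

lemma tensorSpline_eq_sum (d : Fin (numB p r k) → Fin (numB p r k) → ℝ) (x : ℝ × ℝ) :
    tensorSpline p r τ d x = ∑ i, (∑ j, d i j * N p r τ j x.2) * N p r τ i x.1 := by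
  simp only [tensorSpline, smul_eq_mul, Finset.sum_mul]
  exact Finset.sum_congr rfl fun i _ => Finset.sum_congr rfl fun j _ => by ring

lemma tensorSpline_coeff_eq_zero (hτ : StrictMono τ) (hτ01 : ∀ i, 0 < τ i ∧ τ i < 1)
    {d : Fin (numB p r k) → Fin (numB p r k) → ℝ}
    (hd : ∀ x ∈ unitSquare, tensorSpline p r τ d x = 0) : d = 0 := by
  have h1 : ∀ v ∈ Icc (0 : ℝ) 1, ∀ i, ∑ j, d i j * N p r τ j v = 0 := by
    intro v hv i
    refine congrFun (bspline_coeff_eq_zero hτ hτ01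
      (c := fun i => ∑ j, d i j * N p r τ j v) fun u hu => ?_) i
    rw [← hd (u, v) ⟨hu, hv⟩, tensorSpline_eq_sum]
  exact funext fun i => bspline_coeff_eq_zero hτ hτ01 fun v hv => h1 v hv i

lemma tensorSpline_sub (d e : Fin (numB p r k) → Fin (numB p r k) → ℝ) (x : ℝ × ℝ) :
    tensorSpline p r τ (d - e) x = tensorSpline p r τ d x - tensorSpline p r τ e x := by
  simp [tensorSpline, mul_sub, Finset.sum_sub_distrib]

lemma columnSpace_mono {J K : Set ℕ} (h : J ⊆ K) : columnSpace p r τ F J ≤ columnSpace p r τ F K :=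
  fun _ hφ S => let ⟨d, hd, hd'⟩ := hφ S
    ⟨d, fun i j hi => hd i j fun h' => hi (h h'), hd'⟩

lemma disjoint_columnSpace (hτ : StrictMono τ) (hτ01 : ∀ i, 0 < τ i ∧ τ i < 1) {J K : Set ℕ}
    (h : Disjoint J K) : Disjoint (columnSpace p r τ F J) (columnSpace p r τ F K) := by
  refine Submodule.disjoint_def.2 fun φ hJ hK => funext fun ⟨y, hy⟩ => ?_
  obtain ⟨S, x, hx, rfl⟩ := mem_iUnion.1 hy
  obtain ⟨d, hd, hd'⟩ := hJ S
  obtain ⟨e, he, he'⟩ := hK S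
  have hde : d - e = 0 := tensorSpline_coeff_eq_zero hτ hτ01 fun x hx => by
    rw [tensorSpline_sub, ← hd' ⟨x, hx⟩, ← he' ⟨x, hx⟩, sub_self]
  have hd0 : d = 0 := by
    ext i j
    by_cases hi : (i : ℕ) ∈ J
    · rw [sub_eq_zero.1 hde]
      exact he i j (Set.disjoint_left.1 h hi)
    · exact hd i j hi
  have := hd' ⟨x, hx⟩
  rw [hd0] at this
  exact this.trans (by simp [tensorSpline])

instance : Fintype Side := ⟨⟨{.L, .R}, by simp⟩, fun S => by cases S <;> simp⟩

lemma card_side : Fintype.card Side = 2 := rfl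

/-- The functions in `V²₁` are exactly those with coefficients in the columns `i ≥ 3`. -/
lemma V21_eq_columnSpace (hr : 2 ≤ r) (hrp : r < p) (hτ : StrictMono τ)
    (hτ01 : ∀ i, 0 < τ i ∧ τ i < 1) (hF : IsTwoPatch p r τ F) (hbl : IsBilinearLike F α β) :
    V21 p r τ F = columnSpace p r τ F {i | 3 ≤ i} := by
  refine le_antisymm inf_le_right fun φ hφ =>
    ⟨⟨columnSpace_mono (subset_univ _) hφ, ?_⟩, hφ⟩
  choose d hd hd' using hφ
  choose gt hgt hgt' using fun S => exists_contDiff_ext hr hτ hτ01 (d S)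
  -- The zero triplet: the whole pullback is absorbed in the remainder `u ^ 3 * q`.
  have hz : IsDerivOnI 0 0 := fun v _ => hasDerivWithinAt_const v _ (0 : ℝ)
  refine mem_smoothSpace_of_jets hr hτ hτ01 hF hbl hgt
    (fun S x => (hd' S x).trans (hgt' S x x.2)) hz hz hz (g₂ := 0) (tau₁_pos hτ01)
    fun S v hv => ?_
  obtain ⟨q, hq⟩ := sum_bspline_eq_cube_mul (P := p) (R := r) hτ hτ01 hrp
    (Finset.univ.filter fun i : Fin (numB p r k) => 3 ≤ (i : ℕ)) (fun i => i)
    (fun i hi => (Finset.mem_filter.1 hi).2) (fun i => ∑ j, d S i j * N p r τ j v)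
  refine ⟨q, fun u hu hu' => ?_⟩
  rw [← hgt' S (u, v) ⟨⟨hu, hu'.le.trans (tau₁_le_one hτ01)⟩, hv⟩, tensorSpline_eq_sum,
    ← hq u hu hu', Finset.sum_filter]
  simp only [Pi.zero_apply, mul_zero, add_zero, zero_mul, zero_add]
  refine Finset.sum_congr rfl fun i _ => ?_
  split_ifs with hi
  · exact mul_comm _ _
  · simp [hd S i _ hi]

lemma finrank_V21 (hr : 2 ≤ r) (hrp : r + 2 ≤ p) (hτ : StrictMono τ)
    (hτ01 : ∀ i, 0 < τ i ∧ τ i < 1) (hF : IsTwoPatch p r τ F) (hbl : IsBilinearLike F α β) :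
    FiniteDimensional ℝ (V21 p r τ F) ∧
      Module.finrank ℝ (V21 p r τ F) = 2 * ((numB p r k - 3) * numB p r k) := by
  classical
  let ext : (Side → {i : Fin (numB p r k) // 3 ≤ (i : ℕ)} → Fin (numB p r k) → ℝ) → Side →
      Fin (numB p r k) → Fin (numB p r k) → ℝ :=
    fun c S i j => if h : 3 ≤ (i : ℕ) then c S ⟨i, h⟩ j else 0
  have ext_eq : ∀ c S i j, ext c S i j = if h : 3 ≤ (i : ℕ) then c S ⟨i, h⟩ j else 0 :=
    fun _ _ _ _ => rfl
  let E : Side → ℝ × ℝ → (Side → {i : Fin (numB p r k) // 3 ≤ (i : ℕ)} → Fin (numB p r k) → ℝ)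
      →ₗ[ℝ] ℝ := fun S x =>
    { toFun := fun c => tensorSpline p r τ (ext c S) x
      map_add' := fun c c' => by
        simp only [tensorSpline, ← Finset.sum_add_distrib, ← smul_add]
        refine Finset.sum_congr rfl fun i _ => Finset.sum_congr rfl fun j _ => ?_
        rw [ext_eq, ext_eq, ext_eq]
        split_ifs <;> simp
      map_smul' := fun a c => by
        simp only [tensorSpline, RingHom.id_apply, Finset.smul_sum]
        refine Finset.sum_congr rfl fun i _ => Finset.sum_congr rfl fun j _ => ?_
        rw [ext_eq, ext_eq, smul_comm]
        split_ifs <;> simp }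
  have hE : ∀ S x c, E S x c = tensorSpline p r τ (ext c S) x := fun _ _ _ => rfl
  have hE0 : ∀ S v, E S (0, v) = 0 := by
    intro S v
    refine LinearMap.ext fun c => ?_
    rw [hE, tensorSpline_eq_sum]
    refine Finset.sum_eq_zero fun i _ => ?_
    by_cases hi : 3 ≤ (i : ℕ)
    · obtain ⟨q, hq⟩ := bspline_eq_cube_mul (P := p) (R := r) hτ hτ01 (by omega) hi
      rw [hq 0 le_rfl (tau₁_pos hτ01)]
      simp
    · simp [ext_eq, hi]
  have key := finrank_of_parametrization hF E (fun v _ => by rw [hE0, hE0]) (fun c hc => ?_)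
    (W := V21 p r τ F) fun φ => ?_
  · refine ⟨key.1, key.2.trans ?_⟩
    have hcard : Fintype.card {i : Fin (numB p r k) // 3 ≤ (i : ℕ)} = numB p r k - 3 := by
      have h3 : 3 < numB p r k := by simp only [numB]; omega
      rw [Fintype.card_subtype, ← Fin.card_Ici (⟨3, h3⟩ : Fin (numB p r k))]
      congr 1
      ext i
      simp [Fin.le_def]
    simp only [Module.finrank_pi_fintype, Module.finrank_self, Finset.sum_const,
      Finset.card_univ, card_side, hcard, Fintype.card_fin, smul_eq_mul, mul_one]
  · ext S i j
    have := tensorSpline_coeff_eq_zero hτ hτ01 (hc S)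
    have := congrFun (congrFun this i) j
    rwa [ext_eq, dif_pos i.2] at this
  · rw [V21_eq_columnSpace hr (by omega) hτ hτ01 hF hbl]
    constructor
    · intro h
      choose d hd hd' using h
      refine ⟨fun S i j => d S i j, fun S x => ?_⟩
      rw [hd', hE]
      refine congrArg (fun d => tensorSpline p r τ d x.1) (funext fun i => funext fun j => ?_)
      show d S i j = if 3 ≤ (i : ℕ) then d S i j else 0
      split_ifs with hi
      · rfl
      · exact hd S i j hi
    · rintro ⟨c, hc⟩ S
      exact ⟨ext c S, fun i j hi => dif_neg hi, hc S⟩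

/-! ### Linear parametrizations of univariate splines -/

/-- Splines are replaced by functions on the whole line that depend linearly on the coefficients, so
that ordinary derivatives are available and remain linear in the coefficients. -/
lemma exists_spline_param {P R : ℕ} (hτ : StrictMono τ) (hτ01 : ∀ i, 0 < τ i ∧ τ i < 1) :
    ∃ l : ℝ → (Fin (numB P R k) → ℝ) →ₗ[ℝ] ℝ, (∀ c, (fun v => l v c) ∈ truncSpace P R τ) ∧
      ∀ c, ∀ v ∈ Icc (0 : ℝ) 1, l v c = ∑ i, c i * N P R τ i v := by
  obtain ⟨b, hb⟩ := exists_bspline_ext (P := P) (R := R) hτ hτ01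
  refine ⟨fun v => Fintype.linearCombination ℝ fun i : Fin (numB P R k) => b i v,
    fun c => ?_, fun c v hv => ?_⟩
  · convert Submodule.sum_mem (truncSpace P R τ) fun (i : Fin (numB P R k)) (_ : i ∈ Finset.univ) =>
      Submodule.smul_mem _ (c i) (hb i i.2).1 using 1
    ext v
    simp [Fintype.linearCombination_apply]
  · rw [Fintype.linearCombination_apply]
    exact Finset.sum_congr rfl fun i _ => by rw [(hb i i.2).2 v hv]; rfl

lemma exists_deriv_param {P R : ℕ} {V : Type*} [AddCommGroup V] [Module ℝ V]
    {l : ℝ → V →ₗ[ℝ] ℝ} (hP : 1 ≤ P) (hl : ∀ c, (fun v => l v c) ∈ truncSpace P (R + 1) τ) :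
    ∃ l' : ℝ → V →ₗ[ℝ] ℝ, (∀ c, (fun v => l' v c) ∈ truncSpace (P - 1) R τ) ∧
      ∀ c v, HasDerivAt (fun v => l v c) (l' v c) v := by
  obtain ⟨P, rfl⟩ : ∃ P', P = P' + 1 := ⟨P - 1, by omega⟩
  choose f hf hf' using fun c => exists_deriv_mem_truncSpace (hl c)
  refine ⟨fun v =>
    { toFun := fun c => f c v
      map_add' := fun c d => (hf' (c + d) v).unique (by
        simpa using (hf' c v).fun_add (hf' d v))
      map_smul' := fun a c => (hf' (a • c) v).unique (by
        simpa using (hf' c v).const_mul a) }, hf, hf'⟩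

/-! ### The space `W²₂` -/

lemma combination_eq_zero (hτ : StrictMono τ) (hτ01 : ∀ i, 0 < τ i ∧ τ i < 1) (hrp : r + 2 ≤ p)
    {a b c : ℝ} (h : ∀ u ∈ Icc (0 : ℝ) 1, a * M₀ p r τ u + b * M₁ p r τ u + c * M₂ p r τ u = 0) :
    a = 0 ∧ b = 0 ∧ c = 0 := by
  obtain ⟨q₀, hq₀⟩ := M₀_left hτ hτ01 hrp
  obtain ⟨q₁, hq₁⟩ := M₁_left hτ hτ01 hrp
  obtain ⟨q₂, hq₂⟩ := M₂_left hτ hτ01 hrp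
  have := jet_of_eq_poly (tau₁_pos hτ01) (contDiff_const (c := (0 : ℝ))) (a := a) (b := b) (c := c)
    (q := C a * q₀ + C b * q₁ + C c * q₂) fun u hu hu' => by
      rw [← h u ⟨hu, hu'.le.trans (tau₁_le_one hτ01)⟩, hq₀ u hu hu', hq₁ u hu hu', hq₂ u hu hu']
      simp only [eval_add, eval_mul, eval_C]
      ring
  simpa [eq_comm] using this

/-- Functions represented by splines along the interface lie in `V²₂`. -/
lemma mem_V22_of_repr (hr : 2 ≤ r) (hrp : r + 2 ≤ p) (hτ : StrictMono τ)
    (hτ01 : ∀ i, 0 < τ i ∧ τ i < 1) (hF : IsTwoPatch p r τ F) (hbl : IsBilinearLike F α β)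
    {φ : Ω F → ℝ} {g₀ g₀' g₀'' g₁ g₁' g₂ : ℝ → ℝ} (hd0 : IsDerivOnI g₀ g₀')
    (hd0' : IsDerivOnI g₀' g₀'') (hd1 : IsDerivOnI g₁ g₁')
    (h : HasRepr p r τ F α β φ g₀ g₀' g₀'' g₁ g₁' g₂) (hs0 : IsSpline p r τ g₀)
    (hs1 : ∀ S, IsSpline p r τ fun v => (α S).eval v * g₁ v + (β S).eval v * g₀' v)
    (hs2 : ∀ S, IsSpline p r τ fun v => ((β S).eval v) ^ 2 * g₀'' v +
      2 * (α S).eval v * (β S).eval v * g₁' v + ((α S).eval v) ^ 2 * g₂ v) :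
    φ ∈ V22 p r τ F := by
  obtain ⟨a, ha⟩ := hs0
  choose b hb using hs1
  choose c hc using hs2
  -- Collecting `N_0`, `N_1`, `N_2` in the expansions of `M₀`, `M₁`, `M₂` gives these three columns;
  -- `a`, `b`, `c` are the coefficients of the three factors in `v`.
  let d : Side → ℕ → Fin (numB p r k) → ℝ := fun S i j =>
    if i = 0 then a j else if i = 1 then a j + tau₁ τ / p * b S j else if i = 2 then
      a j + 2 * (tau₁ τ / p) * b S j + tau₁ τ ^ 2 / (p * (p - 1)) * c S j else 0
  have hd3 : ∀ S i j, ¬ i ≤ 2 → d S i j = 0 := by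
    intro S i j hi
    simp only [d]
    rw [if_neg (by omega), if_neg (by omega), if_neg (by omega)]
  have hd : ∀ S, ∀ x ∈ unitSquare, tensorSpline p r τ (fun i j => d S i j) x =
      g₀ x.2 * M₀ p r τ x.1 +
      ((α S).eval x.2 * g₁ x.2 + (β S).eval x.2 * g₀' x.2) * M₁ p r τ x.1 +
      (((β S).eval x.2) ^ 2 * g₀'' x.2 + 2 * (α S).eval x.2 * (β S).eval x.2 * g₁' x.2 +
        ((α S).eval x.2) ^ 2 * g₂ x.2) * M₂ p r τ x.1 := by
    rintro S ⟨u, v⟩ ⟨hu, hv⟩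
    have e : ∑ i : Fin (numB p r k), (∑ j, d S i j * N p r τ j v) * N p r τ i u =
        ∑ i ∈ Finset.range 3, (∑ j, d S i j * N p r τ j v) * N p r τ i u := by
      rw [Fin.sum_univ_eq_sum_range (fun i => (∑ j, d S i j * N p r τ j v) * N p r τ i u)]
      refine (Finset.sum_subset (Finset.range_subset_range.2 (by simp only [numB]; omega))
        fun i _ hi => ?_).symm
      have hi' : ¬ i ≤ 2 := by simpa [Finset.mem_range, Nat.lt_succ_iff] using hi
      simp [hd3 S i _ hi']
    rw [tensorSpline_eq_sum, e]
    have e1 := hb S v hv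
    have e2 := hc S v hv
    simp only at e1 e2 hv ⊢
    rw [e1, e2, ha v hv]
    simp only [Finset.sum_range_succ, Finset.sum_range_zero, zero_add, d, if_true, one_ne_zero,
      if_false, OfNat.ofNat_ne_zero, OfNat.ofNat_ne_one, add_mul, Finset.sum_add_distrib, mul_assoc,
      ← Finset.mul_sum, M₀, M₁, M₂]
    ring
  have hcol : φ ∈ columnSpace p r τ F {i | i ≤ 2} := fun S =>
    ⟨fun i j => d S i j, fun i j hi => hd3 S i j hi, fun x => (h S x).trans (hd S x x.2).symm⟩
  refine ⟨⟨columnSpace_mono (subset_univ _) hcol, ?_⟩, hcol⟩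
  choose gt hgt hgt' using fun S =>
    exists_contDiff_ext (p := p) (r := r) hr hτ hτ01 (fun i j => d S i j)
  obtain ⟨q₀, hq₀⟩ := M₀_left hτ hτ01 hrp
  obtain ⟨q₁, hq₁⟩ := M₁_left hτ hτ01 hrp
  obtain ⟨q₂, hq₂⟩ := M₂_left hτ hτ01 hrp
  refine mem_smoothSpace_of_jets hr hτ hτ01 hF hbl hgt (fun S x => ?_) hd0 hd0' hd1 (g₂ := g₂)
    (tau₁_pos hτ01) fun S v hv => ?_
  · rw [← hgt' S x x.2, hd S x x.2]
    exact h S x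
  · refine ⟨C (g₀ v) * q₀ + C ((α S).eval v * g₁ v + (β S).eval v * g₀' v) * q₁ +
      C (((β S).eval v) ^ 2 * g₀'' v + 2 * (α S).eval v * (β S).eval v * g₁' v +
        ((α S).eval v) ^ 2 * g₂ v) * q₂, fun u hu hu' => ?_⟩
    have hx : (u, v) ∈ unitSquare := ⟨⟨hu, hu'.le.trans (tau₁_le_one hτ01)⟩, hv⟩
    rw [← hgt' S _ hx, hd S _ hx]
    simp only [hq₀ u hu hu', hq₁ u hu hu', hq₂ u hu hu', eval_add, eval_mul, eval_C]
    ring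

lemma finrank_W22 (hr : 2 ≤ r) (hrp : r + 3 ≤ p) (hτ : StrictMono τ)
    (hτ01 : ∀ i, 0 < τ i ∧ τ i < 1) (hF : IsTwoPatch p r τ F) (hbl : IsBilinearLike F α β) :
    FiniteDimensional ℝ (W22 p r τ F α β) ∧
      Module.finrank ℝ (W22 p r τ F α β) = numB p (r + 2) k +
        (numB (p - degAlpha α) (r + 1) k + numB (p - 2 * degAlpha α) r k) := by
  have hδ : degAlpha α ≤ 1 := max_le (hbl.degα _) (hbl.degα _)
  have hαδ : ∀ S, (α S).natDegree ≤ degAlpha α := by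
    rintro (_ | _)
    · exact le_max_left _ _
    · exact le_max_right _ _
  set δ := degAlpha α
  obtain ⟨l₀, hl₀, hl₀N⟩ := exists_spline_param (P := p) (R := r + 2) hτ hτ01
  obtain ⟨l₁, hl₁, hl₁N⟩ := exists_spline_param (P := p - δ) (R := r + 1) hτ hτ01
  obtain ⟨l₂, hl₂, hl₂N⟩ := exists_spline_param (P := p - 2 * δ) (R := r) hτ hτ01
  obtain ⟨l₀', hl₀', hd₀⟩ := exists_deriv_param (R := r + 1) (by omega) hl₀
  obtain ⟨l₀'', hl₀'', hd₀'⟩ := exists_deriv_param (R := r) (by omega) hl₀'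
  obtain ⟨l₁', hl₁', hd₁⟩ := exists_deriv_param (R := r) (by omega) hl₁
  let E : Side → ℝ × ℝ → ((Fin (numB p (r + 2) k) → ℝ) × (Fin (numB (p - δ) (r + 1) k) → ℝ) ×
      (Fin (numB (p - 2 * δ) r k) → ℝ)) →ₗ[ℝ] ℝ := fun S x =>
    { toFun := fun c => l₀ x.2 c.1 * M₀ p r τ x.1 +
        ((α S).eval x.2 * l₁ x.2 c.2.1 + (β S).eval x.2 * l₀' x.2 c.1) * M₁ p r τ x.1 +
        (((β S).eval x.2) ^ 2 * l₀'' x.2 c.1 +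
          2 * (α S).eval x.2 * (β S).eval x.2 * l₁' x.2 c.2.1 +
          ((α S).eval x.2) ^ 2 * l₂ x.2 c.2.2) * M₂ p r τ x.1
      map_add' := fun c d => by
        simp only [Prod.fst_add, Prod.snd_add, map_add]
        ring
      map_smul' := fun a c => by
        simp only [Prod.smul_fst, Prod.smul_snd, map_smul, smul_eq_mul, RingHom.id_apply]
        ring }
  have hE : ∀ S x c, E S x c = l₀ x.2 c.1 * M₀ p r τ x.1 +
        ((α S).eval x.2 * l₁ x.2 c.2.1 + (β S).eval x.2 * l₀' x.2 c.1) * M₁ p r τ x.1 +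
        (((β S).eval x.2) ^ 2 * l₀'' x.2 c.1 +
          2 * (α S).eval x.2 * (β S).eval x.2 * l₁' x.2 c.2.1 +
          ((α S).eval x.2) ^ 2 * l₂ x.2 c.2.2) * M₂ p r τ x.1 := fun _ _ _ => rfl
  have hE0 : ∀ S v c, E S (0, v) c = l₀ v c.1 := by
    intro S v c
    obtain ⟨q₀, hq₀⟩ := M₀_left (P := p) (R := r) hτ hτ01 (by omega)
    obtain ⟨q₁, hq₁⟩ := M₁_left (P := p) (R := r) hτ hτ01 (by omega)
    obtain ⟨q₂, hq₂⟩ := M₂_left (P := p) (R := r) hτ hτ01 (by omega)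
    rw [hE]
    simp only [hq₀ 0 le_rfl (tau₁_pos hτ01), hq₁ 0 le_rfl (tau₁_pos hτ01),
      hq₂ 0 le_rfl (tau₁_pos hτ01)]
    ring
  have key := finrank_of_parametrization hF E
    (fun v _ => LinearMap.ext fun c => by rw [hE0, hE0]) (fun c hc => ?_)
    (W := W22 p r τ F α β) fun φ => ?_
  · refine ⟨key.1, key.2.trans ?_⟩
    simp only [Module.finrank_prod, Module.finrank_fintype_fun_eq_card, Fintype.card_fin]
  · have h : ∀ S, ∀ v ∈ Icc (0 : ℝ) 1, l₀ v c.1 = 0 ∧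
        (α S).eval v * l₁ v c.2.1 + (β S).eval v * l₀' v c.1 = 0 ∧
        ((β S).eval v) ^ 2 * l₀'' v c.1 + 2 * (α S).eval v * (β S).eval v * l₁' v c.2.1 +
          ((α S).eval v) ^ 2 * l₂ v c.2.2 = 0 := fun S v hv =>
      combination_eq_zero (p := p) (r := r) hτ hτ01 (by omega) fun u hu => (hE S (u, v) c).symm.trans
        (hc S (u, v) ⟨hu, hv⟩)
    have hα : ∀ v ∈ Icc (0 : ℝ) 1, (α .L).eval v ≠ 0 := fun v hv =>
      (mul_ne_zero_iff.1 (hbl.sign v hv).ne).1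
    have h0 : c.1 = 0 := bspline_coeff_eq_zero hτ hτ01 fun v hv => by
      rw [← hl₀N _ v hv]
      exact (h .L v hv).1
    have h1 : c.2.1 = 0 := bspline_coeff_eq_zero hτ hτ01 fun v hv => by
      have := (h .L v hv).2.1
      rw [h0, map_zero, mul_zero, add_zero] at this
      rw [← hl₁N _ v hv]
      exact (mul_eq_zero.1 this).resolve_left (hα v hv)
    have h2 : c.2.2 = 0 := bspline_coeff_eq_zero hτ hτ01 fun v hv => by
      have := (h .L v hv).2.2
      rw [h0, h1, map_zero, map_zero, mul_zero, mul_zero, add_zero, zero_add] at this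
      rw [← hl₂N _ v hv]
      exact (mul_eq_zero.1 this).resolve_left (pow_ne_zero 2 (hα v hv))
    exact Prod.ext h0 (Prod.ext h1 h2)
  · have toI : ∀ {g g' : ℝ → ℝ}, (∀ v, HasDerivAt g (g' v) v) → IsDerivOnI g g' :=
      fun h v _ => (h v).hasDerivWithinAt
    constructor
    · rintro ⟨-, g₀, g₀', g₀'', g₁, g₁', g₂, ⟨c₀, hc₀⟩, ⟨c₁, hc₁⟩, ⟨c₂, hc₂⟩, k0, k0', k1, hrep⟩
      -- The derivatives in a representation are known only on `[0,1]`, where uniqueness identifies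
      -- them with those of the parametrized splines.
      have congrI : ∀ {g h g' : ℝ → ℝ}, (∀ v ∈ Icc (0 : ℝ) 1, g v = h v) → IsDerivOnI g g' →
          IsDerivOnI h g' := fun e hd v hv =>
        (hd v hv).congr (fun s hs => (e s hs).symm) (e v hv).symm
      have e0 : ∀ v ∈ Icc (0 : ℝ) 1, g₀ v = l₀ v c₀ := fun v hv => by
        rw [hc₀ v hv, hl₀N _ v hv]
      have e1 : ∀ v ∈ Icc (0 : ℝ) 1, g₁ v = l₁ v c₁ := fun v hv => by
        rw [hc₁ v hv, hl₁N _ v hv]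
      have e2 : ∀ v ∈ Icc (0 : ℝ) 1, g₂ v = l₂ v c₂ := fun v hv => by
        rw [hc₂ v hv, hl₂N _ v hv]
      have e0' : ∀ v ∈ Icc (0 : ℝ) 1, g₀' v = l₀' v c₀ := fun v hv =>
        (congrI e0 k0).eq (toI (hd₀ c₀)) hv
      have e0'' : ∀ v ∈ Icc (0 : ℝ) 1, g₀'' v = l₀'' v c₀ := fun v hv =>
        (congrI e0' k0').eq (toI (hd₀' c₀)) hv
      have e1' : ∀ v ∈ Icc (0 : ℝ) 1, g₁' v = l₁' v c₁ := fun v hv =>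
        (congrI e1 k1).eq (toI (hd₁ c₁)) hv
      refine ⟨(c₀, c₁, c₂), fun S x => ?_⟩
      have hv := x.2.2
      rw [hrep S x, hE, e0 _ hv, e1 _ hv, e2 _ hv, e0' _ hv, e0'' _ hv, e1' _ hv]
    · rintro ⟨⟨c₀, c₁, c₂⟩, hc⟩
      have spl : ∀ {P R : ℕ} {g : ℝ → ℝ}, g ∈ truncSpace P R τ → IsSpline P R τ g :=
        fun hg => (isSpline_iff hτ hτ01).2 ⟨_, hg, fun _ _ => rfl⟩
      have k0 := toI (hd₀ c₀)
      have k0' := toI (hd₀' c₀)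
      have k1 := toI (hd₁ c₁)
      have hrep : HasRepr p r τ F α β φ (fun v => l₀ v c₀) (fun v => l₀' v c₀)
          (fun v => l₀'' v c₀) (fun v => l₁ v c₁) (fun v => l₁' v c₁) (fun v => l₂ v c₂) := hc
      refine ⟨mem_V22_of_repr hr (by omega) hτ hτ01 hF hbl k0 k0' k1 hrep ?_ (fun S => spl ?_)
        (fun S => spl ?_), _, _, _, _, _, _, spl (hl₀ c₀), spl (hl₁ c₁), spl (hl₂ c₂), k0, k0',
        k1, hrep⟩
      · exact spl (truncSpace_mono le_rfl (by omega) (hl₀ c₀))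
      · exact Submodule.add_mem _
          (truncSpace_mono (by omega) (by omega) (poly_mul_mem_truncSpace hδ (hαδ S) (hl₁ c₁)))
          (truncSpace_mono (by omega) (by omega)
            (linear_mul_mem_truncSpace (hbl.degβ S) (hl₀' c₀)))
      · have h0 := linear_mul_mem_truncSpace (hbl.degβ S)
          (linear_mul_mem_truncSpace (hbl.degβ S) (hl₀'' c₀))
        have h1 := poly_mul_mem_truncSpace hδ (hαδ S)
          (linear_mul_mem_truncSpace (hbl.degβ S) (hl₁' c₁))
        have h2 := poly_mul_mem_truncSpace hδ (hαδ S) (poly_mul_mem_truncSpace hδ (hαδ S) (hl₂ c₂))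
        have := Submodule.add_mem _ (Submodule.add_mem _
          (truncSpace_mono (P' := p) (R' := r) (by omega) le_rfl h0)
          (Submodule.smul_mem _ 2 (truncSpace_mono (P' := p) (R' := r) (by omega) le_rfl h1)))
          (truncSpace_mono (P' := p) (R' := r) (by omega) le_rfl h2)
        convert this using 1
        ext v
        simp only [Pi.add_apply, Pi.smul_apply, smul_eq_mul]
        ring

end Dimension

end TwoPatch

/-! ### The dimension formula -/

theorem corollary4 (p r k : ℕ) (hp : 5 ≤ p) (hr : 2 ≤ r) (hrp : r + 3 ≤ p)
    (τ : Fin k → ℝ) (hτ : StrictMono τ) (hτ01 : ∀ i, 0 < τ i ∧ τ i < 1)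
    (F : TwoPatch.Side → ℝ × ℝ → ℝ × ℝ) (α β : TwoPatch.Side → Polynomial ℝ)
    (hF : TwoPatch.IsTwoPatch p r τ F) (hbl : TwoPatch.IsBilinearLike F α β) :
    FiniteDimensional ℝ (TwoPatch.W2 p r τ F α β) ∧
    (Module.finrank ℝ (TwoPatch.W22 p r τ F α β) : ℤ) =
      ((k : ℤ) + 1) * (3 * p - 3 * TwoPatch.degAlpha α) + 3 * (1 - k - k * r) ∧
    (Module.finrank ℝ (TwoPatch.V21 p r τ F) : ℤ) =
      2 * ((p : ℤ) - 2 + k * ((p : ℤ) - r)) * ((p : ℤ) + 1 + k * ((p : ℤ) - r)) ∧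
    Disjoint (TwoPatch.V21 p r τ F) (TwoPatch.W22 p r τ F α β) ∧
    (Module.finrank ℝ (TwoPatch.W2 p r τ F α β) : ℤ) =
      2 * ((p : ℤ) - 2 + k * ((p : ℤ) - r)) * ((p : ℤ) + 1 + k * ((p : ℤ) - r)) +
        (((k : ℤ) + 1) * (3 * p - 3 * TwoPatch.degAlpha α) + 3 * (1 - k - k * r)) := by
  obtain ⟨hfV, hV⟩ := TwoPatch.finrank_V21 hr (by omega) hτ hτ01 hF hbl
  obtain ⟨hfW, hW⟩ := TwoPatch.finrank_W22 hr hrp hτ hτ01 hF hbl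
  have hδ : TwoPatch.degAlpha α ≤ 1 := max_le (hbl.degα _) (hbl.degα _)
  have hdisj : Disjoint (TwoPatch.V21 p r τ F) (TwoPatch.W22 p r τ F α β) := by
    refine (TwoPatch.disjoint_columnSpace hτ hτ01 (J := {i | 3 ≤ i}) (K := {i | i ≤ 2})
      ?_).mono (fun φ hφ => hφ.2) fun φ hφ => hφ.1.2
    exact Set.disjoint_left.2 fun i (h1 : 3 ≤ i) (h2 : i ≤ 2) => by omega
  have hWz : (Module.finrank ℝ (TwoPatch.W22 p r τ F α β) : ℤ) =
      ((k : ℤ) + 1) * (3 * p - 3 * TwoPatch.degAlpha α) + 3 * (1 - k - k * r) := by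
    rw [hW]
    generalize TwoPatch.degAlpha α = δ at hδ
    simp only [TwoPatch.numB]
    -- All natural subtractions are genuine: `r + 3 ≤ p` and `δ ≤ 1` give `r + 1 ≤ p - δ` and `r ≤ p
    -- - 2 * δ`.
    push_cast [Nat.cast_sub (show r + 2 ≤ p by omega), Nat.cast_sub (show δ ≤ p by omega),
      Nat.cast_sub (show 2 * δ ≤ p by omega), Nat.cast_sub (show r + 1 ≤ p - δ by omega),
      Nat.cast_sub (show r ≤ p - 2 * δ by omega)]
    ring
  have hVz : (Module.finrank ℝ (TwoPatch.V21 p r τ F) : ℤ) =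
      2 * ((p : ℤ) - 2 + k * ((p : ℤ) - r)) * ((p : ℤ) + 1 + k * ((p : ℤ) - r)) := by
    rw [hV]
    have : TwoPatch.numB p r k - 3 = p - 2 + k * (p - r) := by simp only [TwoPatch.numB]; omega
    rw [this]
    push_cast [Nat.cast_sub (show 2 ≤ p by omega), Nat.cast_sub (show r ≤ p by omega)]
    ring
  have hsup := Submodule.finrank_sup_add_finrank_inf_eq (TwoPatch.V21 p r τ F)
    (TwoPatch.W22 p r τ F α β)
  rw [hdisj.eq_bot, finrank_bot, add_zero] at hsup
  refine ⟨Submodule.finiteDimensional_sup _ _, hWz, hVz, hdisj, ?_⟩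
  rw [← hVz, ← hWz, TwoPatch.W2, hsup]
  push_cast
  rfl
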